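/- Let $b\ge 3$ and let $S$ be a sphere with $b+1$ holes, with fundamental group $\langle g_1,\dots,g_{b+1}\mid g_1g_2\cdots g_{b+1}=1\rangle$, where the $g_i$ are the standard boundary loops; it is free on $g_1,\dots,g_b$. Let $\mathbb R^{2,1}$ be $\mathbb R^3$ with $B(x,y)=x_1y_1+x_2y_2-x_3y_3$, and identify $\mathrm{PSL}(2,\mathbb R)$ with $SO^0(2,1)$. Fix a Fuchsian holonomy of $S$, i.e. a faithful representation of its fundamental group with discrete image $G_b\subset SO^0(2,1)$ such that $\mathbb H^2/G_b$ is (the interior of) $S$, inducing the given marking by the $g_i$, and suppose that all $g_i$ $(1\le i\le b+1)$ are sent to hyperbolic elements (elements with three different real eigenvalues). We regard the $g_i$ as elements of $G_b$. For hyperbolic $g$ with eigenvalues $\lambda_g,1,\lambda_g^{-1}$, $0<\lambda_g<1$, let $X_g^-,X_g^0,X_g^+$ be the corresponding eigenvectors, where $X_g^\pm$ are null, future-pointing and of Euclidean length $1$, $B(X_g^0,X_g^0)=1$ and $\det(X_g^0,X_g^-,X_g^+)>0$. A cocycle is a map $u:G_b\to\mathbb R^{2,1}$ with $u(gh)=g\,u(h)+u(g)$;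 the coboundary of $v\in\mathbb R^{2,1}$ is $\delta_v(g)=v-gv$; $Z^1(G_b,\mathbb R^{2,1})$ and $H^1(G_b,\mathbb R^{2,1})$ are the spaces of cocycles and of cocycles modulo coboundaries. The Margulis invariant of $u$ at a hyperbolic $g$ is $\alpha_u(g)=B(u(g),X_g^0)$. For $1\le j\le b-2$ let $h_j=g_{j+1}^{-1}g_j^{-1}\cdots g_1^{-1}$; these are the dividing curves of a pants decomposition with pants groups $P_1=\langle g_1,g_2,h_1\rangle$, $P_j=\langle h_{j-1},g_{j+1},h_j\rangle$ $(2\le j\le b-2)$ and $P_{b-1}=\langle h_{b-2},g_b,g_{b+1}\rangle$. Put $D_b=\{(\alpha,\beta,t):\alpha\in\mathbb R^{b+1},\ \beta,t\in\mathbb R^{b-2}\}$, a real vector space of dimension $3b-3$. Then: 1. All $h_j$ are hyperbolic; write $Y_j^0=X_{h_j}^0$. 2. For all $\alpha\in\mathbb R^{b+1}$, $\beta\in\mathbb R^{b-2}$ there is exactly one cocycle $u_0^{\alpha,\beta}$ on $G_b$ such that $\alpha_{u_0}(g_i)=\alpha_i$ $(1\le i\le b+1)$, $\alpha_{u_0}(h_j)=\beta_j$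 $(1\le j\le b-2)$, $u_0(g_1)=\alpha_1X_{g_1}^0$, and $u_0(g_i)-\alpha_iX_{g_i}^0\in\mathbb R X_{g_i}^+$ for $2\le i\le b$. It depends linearly on $(\alpha,\beta)$. 3. For $1\le k\le b-2$ there is exactly one cocycle $\mathrm{AT}_k$ on $G_b$ (the affine twist) that is zero on $P_1,\dots,P_k$ and equal to $\delta_{Y_k^0}$ on $P_{k+1},\dots,P_{b-1}$. 4. The map $D_b\to H^1(G_b,\mathbb R^{2,1})$, $(\alpha,\beta,t)\mapsto\bigl[u_0^{\alpha,\beta}+\sum_{k=1}^{b-2}t_k\,\mathrm{AT}_k\bigr]$, is a linear isomorphism. Every cocycle $u$ in the class that corresponds to $(\alpha,\beta,t)$ has the Margulis invariants $\alpha_u(g_i)=\alpha_i$ and $\alpha_u(h_j)=\beta_j$. -/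

import Mathlib

noncomputable section

namespace HoledSphere

/-- The vector space `ℝ^{2,1}`. Its Lorentzian form is `lorentz`. -/
abbrev R21 : Type := Fin 3 → ℝ

/-- The Lorentzian inner product `B(x, y) = x₁ y₁ + x₂ y₂ - x₃ y₃`. -/
def lorentz (x y : R21) : ℝ := x 0 * y 0 + x 1 * y 1 - x 2 * y 2

/-- Future-pointing timelike vectors. -/
def IsFutureTimelike (x : R21) : Prop := lorentz x x < 0 ∧ 0 < x 2

lemma isFutureTimelike_or_neg {x : R21} (hx : lorentz x x < 0) :
    IsFutureTimelike x ∨ IsFutureTimelike (-x) := by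
  rcases lt_trichotomy (x 2) 0 with h | h | h
  · right
    refine ⟨?_, by simpa using h⟩
    simpa [lorentz] using hx
  · exfalso
    simp only [lorentz, h] at hx
    nlinarith [sq_nonneg (x 0), sq_nonneg (x 1)]
  · exact Or.inl ⟨hx, h⟩

open Matrix in
/-- `SO⁰(2,1)`: the matrices of determinant one that preserve the Lorentzian inner product and the
time orientation. -/
def SO21 : Subgroup (Matrix.SpecialLinearGroup (Fin 3) ℝ) where
  carrier := {A | (∀ x y : R21, lorentz (A.1 *ᵥ x) (A.1 *ᵥ y) = lorentz x y) ∧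
    ∀ x : R21, IsFutureTimelike x → IsFutureTimelike (A.1 *ᵥ x)}
  one_mem' := by simp
  mul_mem' := by
    rintro A C ⟨hA, hA'⟩ ⟨hC, hC'⟩
    refine ⟨fun x y => ?_, fun x hx => ?_⟩
    · rw [Matrix.SpecialLinearGroup.coe_mul, ← Matrix.mulVec_mulVec, ← Matrix.mulVec_mulVec,
        hA, hC]
    · rw [Matrix.SpecialLinearGroup.coe_mul, ← Matrix.mulVec_mulVec]
      exact hA' _ (hC' _ hx)
  inv_mem' := by
    rintro A ⟨hA, hA'⟩
    have key : ∀ x : R21, A.1 *ᵥ ((A⁻¹).1 *ᵥ x) = x := fun x => by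
      rw [Matrix.mulVec_mulVec, ← Matrix.SpecialLinearGroup.coe_mul, mul_inv_cancel,
        Matrix.SpecialLinearGroup.coe_one, Matrix.one_mulVec]
    have hB : ∀ x y : R21, lorentz ((A⁻¹).1 *ᵥ x) ((A⁻¹).1 *ᵥ y) = lorentz x y := fun x y => by
      rw [← hA, key, key]
    refine ⟨hB, fun x hx => ?_⟩
    rcases isFutureTimelike_or_neg (x := (A⁻¹).1 *ᵥ x) (by rw [hB]; exact hx.1) with h | h
    · exact h
    · exfalso
      have h2 := (hA' _ h).2
      rw [Matrix.mulVec_neg, key] at h2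
      have h3 := hx.2
      simp only [Pi.neg_apply] at h2
      linarith

/-- The linear action of `SO⁰(2,1)` on `ℝ^{2,1}`. -/
def act (A : SO21) (x : R21) : R21 := A.1.1.mulVec x

/-- The hyperbolic plane: future-pointing unit timelike vectors, with the subspace topology. -/
def Hyp : Type := {x : R21 // lorentz x x = -1 ∧ 0 < x 2}

instance : TopologicalSpace Hyp := inferInstanceAs (TopologicalSpace (Subtype _))

lemma act_mem_hyp (A : SO21) (x : Hyp) :
    lorentz (act A x.1) (act A x.1) = -1 ∧ 0 < act A x.1 2 :=
  ⟨(A.2.1 _ _).trans x.2.1, (A.2.2 _ ⟨by rw [x.2.1]; norm_num, x.2.2⟩).2⟩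

/-- `SO⁰(2,1)` acts on the hyperbolic plane. -/
instance : MulAction SO21 Hyp where
  smul A x := ⟨act A x.1, act_mem_hyp A x⟩
  one_smul x := Subtype.ext (Matrix.one_mulVec x.1)
  mul_smul A C x := Subtype.ext (Matrix.mulVec_mulVec x.1 A.1.1 C.1.1).symm

/-- An element of `SO⁰(2,1)` is hyperbolic if it has three different (real) eigenvalues. -/
def IsHyperbolic (A : SO21) : Prop :=
  ∃ s : Finset ℝ, s.card = 3 ∧ ∀ μ ∈ s, ∃ x : R21, x ≠ 0 ∧ act A x = μ • x

/-- Data `(λ, X⁻, X⁰, X⁺)`. -/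
structure Frame where
  lam : ℝ
  minus : R21
  zero : R21
  plus : R21

instance : Nonempty Frame := ⟨⟨0, 0, 0, 0⟩⟩

/-- The normalized eigenvectors `X_g⁻`, `X_g⁰`, `X_g⁺` of a hyperbolic element, with eigenvalues
`λ_g`, `1`, `λ_g⁻¹`, where `0 < λ_g < 1`. The null eigenvectors are future-pointing and of Euclidean
length one. -/
structure IsFrame (A : SO21) (f : Frame) : Prop where
  lam_pos : 0 < f.lam
  lam_lt_one : f.lam < 1
  act_minus : act A f.minus = f.lam • f.minus
  act_zero : act A f.zero = f.zero
  act_plus : act A f.plus = f.lam⁻¹ • f.plus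
  null_minus : lorentz f.minus f.minus = 0
  null_plus : lorentz f.plus f.plus = 0
  length_minus : f.minus 0 ^ 2 + f.minus 1 ^ 2 + f.minus 2 ^ 2 = 1
  length_plus : f.plus 0 ^ 2 + f.plus 1 ^ 2 + f.plus 2 ^ 2 = 1
  future_minus : 0 < f.minus 2
  future_plus : 0 < f.plus 2
  unit_zero : lorentz f.zero f.zero = 1
  det_pos : 0 < (Matrix.of ![f.zero, f.minus, f.plus]).det

/-- The frame of a hyperbolic element (junk for other elements). -/
def frame (A : SO21) : Frame := Classical.epsilon (IsFrame A)

/-- The eigenvector `X_g⁰`. -/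
def X0 (A : SO21) : R21 := (frame A).zero

/-- The eigenvector `X_g⁺`. -/
def Xplus (A : SO21) : R21 := (frame A).plus

/-- `g₁ g₂ ⋯ gₙ` in the free group on `g₁, …, g_b`. -/
def initialProd (b n : ℕ) : FreeGroup (Fin b) :=
  (((List.finRange b).take n).map FreeGroup.of).prod

/-- The boundary elements `g₁, …, g_b, g_{b+1}` (counted from `0` here), where
`g_{b+1} = (g₁ ⋯ g_b)⁻¹`. -/
def bdry (b : ℕ) (i : Fin (b + 1)) : FreeGroup (Fin b) :=
  if h : i.1 < b then FreeGroup.of ⟨i.1, h⟩ else (initialProd b b)⁻¹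

/-- The dividing elements `h_j = (g₁ ⋯ g_{j+1})⁻¹` for `j = 1, …, b - 2` (counted from `0` here). -/
def divd (b : ℕ) (j : Fin (b - 2)) : FreeGroup (Fin b) := (initialProd b (j.1 + 2))⁻¹

/-- The pants subgroups `P_1, …, P_{b-1}` (counted from `0` here):
`P_1 = ⟨g₁, g₂, h₁⟩`, `P_j = ⟨h_{j-1}, g_{j+1}, h_j⟩`, `P_{b-1} = ⟨h_{b-2}, g_b, g_{b+1}⟩`.
As `(g₁ ⋯ gₙ)⁻¹` is `g₁⁻¹` for `n = 1`, `h_{n-1}` for `1 < n < b` and `g_{b+1}` for `n = b`, one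
formula covers all three cases. -/
def pants (b : ℕ) (j : Fin (b - 1)) : Subgroup (FreeGroup (Fin b)) :=
  Subgroup.closure {(initialProd b (j.1 + 1))⁻¹,
    FreeGroup.of ⟨j.1 + 1, by have := j.2; omega⟩, (initialProd b (j.1 + 2))⁻¹}

/-- The (open) sphere with `b + 1` holes: the Riemann sphere without `0, 1, …, b - 1` and `∞`. -/
abbrev Surface (b : ℕ) : Type := {z : ℂ // ∀ k : Fin b, z ≠ ((k.1 : ℕ) : ℂ)}

/-- The standard loop of the sphere with holes at the base point `i` around the puncture `k`:
straight from `i` to `k + i/3`, once counterclockwise around `k` at distance `1/3`, and back. The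
product, in the order `0, 1, …, n - 1`, of the first `n` loops is homotopic to a simple loop that
goes once around the punctures `0, …, n - 1`. -/
def stdLoop (k : ℕ) (t : ℝ) : ℂ :=
  if t ≤ 1 / 3 then Complex.I + (3 * t : ℝ) * ((k : ℂ) + Complex.I / 3 - Complex.I)
  else if t ≤ 2 / 3 then
    (k : ℂ) + Complex.I / 3 * Complex.exp (2 * Real.pi * Complex.I * (3 * t - 1 : ℝ))
  else Complex.I + (3 * (1 - t) : ℝ) * ((k : ℂ) + Complex.I / 3 - Complex.I)

/-- `ρ` is a Fuchsian holonomy of the sphere with `b + 1` holes, where the free generators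
`g₁, …, g_b` of the fundamental group are the standard loops, and it sends all peripheral elements
to hyperbolic ones: `ρ` is faithful and discrete, the quotient of the hyperbolic plane by its image
is homeomorphic to the sphere with holes, and under this homeomorphism the lift of the `k`-th
standard loop at some point `x₀` over the base point ends at `ρ (g_k) x₀`. -/
structure IsFuchsianHolonomy (b : ℕ) (ρ : FreeGroup (Fin b) →* SO21) : Prop where
  faithful : Function.Injective ρ
  discrete : DiscreteTopology ρ.range
  uniformizes : ∃ (Ψ : MulAction.orbitRel.Quotient ρ.range Hyp ≃ₜ Surface b) (x₀ : Hyp),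
    ∀ k : Fin b, ∃ c : Path x₀ (ρ (FreeGroup.of k) • x₀),
      ∀ t : unitInterval, (Ψ (Quotient.mk _ (c t)) : ℂ) = stdLoop k.1 t.1
  peripheral : ∀ i : Fin (b + 1), IsHyperbolic (ρ (bdry b i))

/-- The representation of the free group on `ℝ^{2,1}` given by `ρ`. -/
def linRep {b : ℕ} (ρ : FreeGroup (Fin b) →* SO21) :
    Representation ℝ (FreeGroup (Fin b)) R21 where
  toFun g := Matrix.mulVecLin (ρ g).1.1
  map_one' := by simp [Module.End.one_eq_id]
  map_mul' g h := by simp [Matrix.mulVecLin_mul, Module.End.mul_eq_comp]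

/-- The coefficient module `ℝ^{2,1}` of the cohomology of `G_b`. -/
abbrev coeff {b : ℕ} (ρ : FreeGroup (Fin b) →* SO21) : Rep ℝ (FreeGroup (Fin b)) :=
  Rep.of (linRep ρ)

/-- The cocycles `Z¹(G_b, ℝ^{2,1})`: maps with `u (g h) = g u(h) + u(g)`. -/
abbrev Z1 {b : ℕ} (ρ : FreeGroup (Fin b) →* SO21) : Submodule ℝ (FreeGroup (Fin b) → R21) :=
  groupCohomology.cocycles₁ (coeff ρ)

/-- The cohomology `H¹(G_b, ℝ^{2,1})`. -/
abbrev H1 {b : ℕ} (ρ : FreeGroup (Fin b) →* SO21) : Type :=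
  groupCohomology.H1 (coeff ρ)

/-- The cohomology class of a cocycle. -/
def cls {b : ℕ} (ρ : FreeGroup (Fin b) →* SO21) : Z1 ρ →ₗ[ℝ] H1 ρ :=
  (groupCohomology.H1π (coeff ρ)).hom

/-- The Margulis invariant `B(γ(x) - x, X_g⁰)` of `γ = (g, u(g))`, evaluated at `x = 0`; it does not
depend on `x`, as `X_g⁰` is fixed by `g`. -/
def margulis {b : ℕ} (ρ : FreeGroup (Fin b) →* SO21) (u : FreeGroup (Fin b) → R21)
    (g : FreeGroup (Fin b)) : ℝ :=
  lorentz (u g) (X0 (ρ g))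

/-- The coboundary `δ_v (g) = v - g v`. -/
def cobdry {b : ℕ} (ρ : FreeGroup (Fin b) →* SO21) (v : R21) (g : FreeGroup (Fin b)) : R21 :=
  v - act (ρ g) v

/-- The parameter space `D_b` of triples `(α, β, t)`. -/
abbrev D (b : ℕ) : Type := (Fin (b + 1) → ℝ) × (Fin (b - 2) → ℝ) × (Fin (b - 2) → ℝ)

/-- The conditions that define `u₀^{α,β}`: its Margulis invariants on the `g_i` and `h_j` are `α_i`
and `β_j`; its value at `g₁` is a multiple of `X₁⁰` (so `c₁⁻ = c₁⁺ = 0`), and its values at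
`g₂, …, g_b` have no component along `X_i⁻` (so `c_i⁻ = 0`). -/
structure IsBaseCocycle {b : ℕ} (ρ : FreeGroup (Fin b) →* SO21) (α : Fin (b + 1) → ℝ)
    (β : Fin (b - 2) → ℝ) (u : FreeGroup (Fin b) → R21) : Prop where
  margulis_bdry : ∀ i, margulis ρ u (bdry b i) = α i
  margulis_divd : ∀ j, margulis ρ u (divd b j) = β j
  first : ∀ i : Fin (b + 1), i.1 = 0 → u (bdry b i) = α i • X0 (ρ (bdry b i))
  next : ∀ i : Fin (b + 1), 0 < i.1 → i.1 < b →
    ∃ c : ℝ, u (bdry b i) = α i • X0 (ρ (bdry b i)) + c • Xplus (ρ (bdry b i))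

/-- The conditions that define the affine twist `AT_k`: it is zero on `P_1, …, P_k` and equals the
coboundary of `Y_k⁰ = X⁰_{h_k}` on `P_{k+1}, …, P_{b-1}`. -/
structure IsAffineTwist {b : ℕ} (ρ : FreeGroup (Fin b) →* SO21) (k : Fin (b - 2))
    (a : FreeGroup (Fin b) → R21) : Prop where
  before : ∀ l : Fin (b - 1), l.1 ≤ k.1 → ∀ g ∈ pants b l, a g = 0
  after : ∀ m : Fin (b - 1), k.1 < m.1 → ∀ g ∈ pants b m, a g = cobdry ρ (X0 (ρ (divd b k))) g

end HoledSphere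

end

/-!
The proof has a topological and an algebraic part.

**Dividing curves are hyperbolic.** Every element `A` of `SO⁰(2,1)` has a nonzero fixed vector
(`exists_fixed_vector`). If it is timelike, then `A` fixes a point of the hyperbolic plane, which a
nontrivial element of a discrete torsion-free group cannot do (`eq_one_of_fixed`). If it is
spacelike and `A ≠ 1`, then `A` is hyperbolic, with the two null lines orthogonal to the fixed
vector as its other eigenspaces (`exists_frame_of_spacelike`). It remains to exclude that `h_j`
fixes a null vector `v`. In that case there are paths from points `x` to `h_j x`, far out towards
`v`, along which `h_j` moves all points by a very short distance (`exists_short_path`). Over a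
compact subset of the surface, all nontrivial group elements move points by at least some positive
distance (`exists_displacement_bound`), so that the loops given by those paths leave every compact
subset. Hence the loop of `h_j` can be moved into a neighbourhood of a puncture or of `∞`, where it
has winding number zero around all other punctures, or the same winding number around all of them
(`IsUniformization.winding_of_parabolic`). But `h_j` has winding number `-1` around `0` and `1`, and
`0` around `b - 1`. The winding numbers are the periods of logarithms of `z - k` lifted to the
hyperbolic plane, which is simply connected; so neither covering spaces of the surface nor its
fundamental group are needed.

**Linear algebra.** If `B(X_g⁺, X_h⁰) = 0` for hyperbolic `g` and `h` in the group, then `X_g⁺` is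
an eigenvector of both. So the conjugates `g⁻ⁿ h gⁿ` converge, and `g` and `h` commute by discreteness
(`commute_of_orthogonal`). In the free group, `g₁ ⋯ gₙ` does not commute with `gₙ₊₁`; so
`B(X⁺, X⁰) ≠ 0` for `gₙ₊₁` and `(g₁ ⋯ gₙ₊₁)⁻¹` (`plus_pairing_ne_zero`), and noncommuting hyperbolic
elements have no common fixed vector (`eq_zero_of_fixed_of_fixed`). Cocycles on the free group are
given by arbitrary values at the generators. The first fact makes the system of equations for `u₀`
triangular (`margulisMap_baseValues_injective`). The second one shows that the linear map
`(α, β, t, v) ↦ u₀^{α,β} + ∑ tₖ ATₖ + δ_v` to the cocycles is injective (`totalMap_injective`).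
As both sides have dimension `3 b`, it is an isomorphism, and division by the coboundaries gives the
parametrization of the cohomology.
-/

noncomputable section

namespace HoledSphere

open Matrix Filter Topology

/-! ### The Lorentzian form and its isometries -/

lemma lorentz_comm (x y : R21) : lorentz x y = lorentz y x := by
  simp only [lorentz]; ring

@[simp] lemma lorentz_add_left (x y z : R21) : lorentz (x + y) z = lorentz x z + lorentz y z := by
  simp only [lorentz, Pi.add_apply]; ring

@[simp] lemma lorentz_add_right (x y z : R21) : lorentz x (y + z) = lorentz x y + lorentz x z := by
  simp only [lorentz, Pi.add_apply]; ring

@[simp] lemma lorentz_sub_left (x y z : R21) : lorentz (x - y) z = lorentz x z - lorentz y z := by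
  simp only [lorentz, Pi.sub_apply]; ring

@[simp] lemma lorentz_sub_right (x y z : R21) : lorentz x (y - z) = lorentz x y - lorentz x z := by
  simp only [lorentz, Pi.sub_apply]; ring

@[simp] lemma lorentz_smul_left (c : ℝ) (x y : R21) : lorentz (c • x) y = c * lorentz x y := by
  simp only [lorentz, Pi.smul_apply, smul_eq_mul]; ring

@[simp] lemma lorentz_smul_right (c : ℝ) (x y : R21) : lorentz x (c • y) = c * lorentz x y := by
  simp only [lorentz, Pi.smul_apply, smul_eq_mul]; ring

@[simp] lemma lorentz_neg_left (x y : R21) : lorentz (-x) y = -lorentz x y := by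
  simp only [lorentz, Pi.neg_apply]; ring

@[simp] lemma lorentz_neg_right (x y : R21) : lorentz x (-y) = -lorentz x y := by
  simp only [lorentz, Pi.neg_apply]; ring

@[simp] lemma lorentz_zero_left (y : R21) : lorentz 0 y = 0 := by simp [lorentz]

lemma continuous_lorentz : Continuous fun p : R21 × R21 => lorentz p.1 p.2 := by
  unfold lorentz; fun_prop

@[simp] lemma lorentz_act (A : SO21) (x y : R21) : lorentz (act A x) (act A y) = lorentz x y :=
  A.2.1 x y

@[simp] lemma act_add (A : SO21) (x y : R21) : act A (x + y) = act A x + act A y :=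
  Matrix.mulVec_add _ _ _

@[simp] lemma act_sub (A : SO21) (x y : R21) : act A (x - y) = act A x - act A y :=
  Matrix.mulVec_sub _ _ _

@[simp] lemma act_neg (A : SO21) (x : R21) : act A (-x) = -act A x :=
  Matrix.mulVec_neg _ _

@[simp] lemma act_smul (A : SO21) (c : ℝ) (x : R21) : act A (c • x) = c • act A x :=
  Matrix.mulVec_smul _ _ _

@[simp] lemma act_zero (A : SO21) : act A 0 = 0 := Matrix.mulVec_zero _

@[simp] lemma act_one (x : R21) : act 1 x = x := Matrix.one_mulVec x

lemma act_mul (A C : SO21) (x : R21) : act (A * C) x = act A (act C x) :=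
  (Matrix.mulVec_mulVec x A.1.1 C.1.1).symm

@[simp] lemma act_inv_act (A : SO21) (x : R21) : act A⁻¹ (act A x) = x := by
  rw [← act_mul, inv_mul_cancel, act_one]

@[simp] lemma act_act_inv (A : SO21) (x : R21) : act A (act A⁻¹ x) = x := by
  rw [← act_mul, mul_inv_cancel, act_one]

lemma act_inv_eq_iff {A : SO21} {x y : R21} : act A⁻¹ x = y ↔ x = act A y :=
  ⟨fun h => by rw [← h, act_act_inv], fun h => by rw [h, act_inv_act]⟩

lemma SO21.ext_act {A C : SO21} (h : ∀ x, act A x = act C x) : A = C :=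
  Subtype.ext (Subtype.ext (Matrix.ext_of_mulVec_single fun _ => h _))

lemma act_pow_smul {A : SO21} {x : R21} {c : ℝ} (h : act A x = c • x) (n : ℕ) :
    act (A ^ n) x = c ^ n • x := by
  induction n with
  | zero => simp
  | succ n ih => rw [pow_succ, act_mul, h, act_smul, ih, smul_smul, pow_succ, mul_comm]

lemma act_inv_smul {A : SO21} {x : R21} {c : ℝ} (hc : c ≠ 0) (h : act A x = c • x) :
    act A⁻¹ x = c⁻¹ • x := by
  rw [act_inv_eq_iff, act_smul, h, smul_smul, inv_mul_cancel₀ hc, one_smul]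

/-- The orthogonal complement of a nonspacelike vector `v` contains no null vectors except the
multiples of `v`. -/
lemma null_orthogonal {v x : R21} (hv : v ≠ 0) (hvv : lorentz v v ≤ 0) (hxx : lorentz x x = 0)
    (hxv : lorentz x v = 0) : ∃ c : ℝ, x = c • v := by
  have hv2 : v 2 ≠ 0 := by
    intro h
    apply hv
    simp only [lorentz, h] at hvv
    have h0 : v 0 = 0 := by nlinarith [sq_nonneg (v 0), sq_nonneg (v 1)]
    have h1 : v 1 = 0 := by nlinarith [sq_nonneg (v 0), sq_nonneg (v 1)]
    ext i; fin_cases i <;> simp [h0, h1, h]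
  refine ⟨x 2 / v 2, ?_⟩
  set c := x 2 / v 2 with hc
  have hy : lorentz (x - c • v) (x - c • v) ≤ 0 := by
    simp only [lorentz_sub_left, lorentz_sub_right, lorentz_smul_left, lorentz_smul_right, hxx, hxv,
      lorentz_comm v x]
    nlinarith [mul_nonneg (sq_nonneg c) (neg_nonneg.2 hvv)]
  have hy2 : (x - c • v) 2 = 0 := by
    simp only [Pi.sub_apply, Pi.smul_apply, smul_eq_mul, hc]; field_simp; ring
  rw [← sub_eq_zero]
  generalize x - c • v = y at hy hy2
  simp only [lorentz, hy2] at hy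
  have h0 : y 0 = 0 := by nlinarith [sq_nonneg (y 0), sq_nonneg (y 1)]
  have h1 : y 1 = 0 := by nlinarith [sq_nonneg (y 0), sq_nonneg (y 1)]
  ext i; fin_cases i <;> simp [h0, h1, hy2]

/-- Every element of `SO⁰(2,1)` has eigenvalue one: if `J` is the Gram matrix of the form, then
`Aᵀ J (A - 1) = -((A - 1)ᵀ) J`, and the determinants of the two sides are `-d` and `d`, where
`d = det (A - 1)`. -/
lemma exists_fixed_vector (A : SO21) : ∃ v : R21, v ≠ 0 ∧ act A v = v := by
  set J : Matrix (Fin 3) (Fin 3) ℝ := Matrix.diagonal ![1, 1, -1] with hJ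
  have hl : ∀ x y : R21, lorentz x y = x ⬝ᵥ (J *ᵥ y) := fun x y => by
    simp [lorentz, hJ, Matrix.mulVec_diagonal, dotProduct, Fin.sum_univ_three]; ring
  have hA : A.1.1ᵀ * J * A.1.1 = J := by
    refine Matrix.ext_of_mulVec_single fun i => ?_
    ext j
    have h := A.2.1 (Pi.single j 1) (Pi.single i 1)
    rw [hl, hl] at h
    rw [← Matrix.mulVec_mulVec, ← Matrix.mulVec_mulVec]
    rw [← Matrix.vecMul_transpose, ← Matrix.dotProduct_mulVec] at h
    simpa [single_dotProduct] using h
  have hd : (A.1.1 - 1).det = 0 := by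
    have h1 : A.1.1ᵀ * J * (A.1.1 - 1) = -((A.1.1 - 1)ᵀ * J) := by
      rw [Matrix.mul_sub, hA, Matrix.transpose_sub, Matrix.sub_mul]
      simp
    have h2 := congrArg Matrix.det h1
    have hJd : J.det = -1 := by simp [hJ, Fin.prod_univ_three]
    rw [Matrix.det_neg, Matrix.det_mul, Matrix.det_mul, Matrix.det_mul, Matrix.det_transpose,
      Matrix.det_transpose, A.1.2, hJd] at h2
    simp at h2
    linarith
  obtain ⟨v, hv, h⟩ := Matrix.exists_mulVec_eq_zero_iff.2 hd
  refine ⟨v, hv, ?_⟩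
  rw [Matrix.sub_mulVec, Matrix.one_mulVec, sub_eq_zero] at h
  exact h

/-- A hyperbolic element has an eigenvalue different from `±1`, whose eigenvectors are null and
orthogonal to all fixed vectors. So they would be multiples of a nonspacelike fixed vector. -/
lemma IsHyperbolic.fixed_spacelike {A : SO21} (hA : IsHyperbolic A) {v : R21} (hv : v ≠ 0)
    (hfix : act A v = v) : 0 < lorentz v v := by
  by_contra! hvv
  obtain ⟨s, hs, hev⟩ := hA
  obtain ⟨μ, hμs, hμ⟩ : ∃ μ ∈ s, μ ∉ ({1, -1} : Finset ℝ) := by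
    by_contra! h
    have := Finset.card_le_card (show s ⊆ {1, -1} from h)
    have h2 : ({1, -1} : Finset ℝ).card ≤ 2 := Finset.card_le_two
    omega
  obtain ⟨x, hx, hAx⟩ := hev μ hμs
  simp only [Finset.mem_insert, Finset.mem_singleton, not_or] at hμ
  have hxx : lorentz x x = 0 := by
    have h := lorentz_act A x x
    rw [hAx, lorentz_smul_left, lorentz_smul_right] at h
    have h2 : (μ - 1) * (μ + 1) * lorentz x x = 0 := by linear_combination h
    have h3 : (μ - 1) * (μ + 1) ≠ 0 :=
      mul_ne_zero (sub_ne_zero.2 hμ.1) fun h => hμ.2 (by linarith)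
    exact (mul_eq_zero.1 h2).resolve_left h3
  have hxv : lorentz x v = 0 := by
    have h := lorentz_act A x v
    rw [hAx, hfix, lorentz_smul_left] at h
    have h2 : (μ - 1) * lorentz x v = 0 := by linear_combination h
    exact (mul_eq_zero.1 h2).resolve_left (sub_ne_zero.2 hμ.1)
  obtain ⟨c, rfl⟩ := null_orthogonal hv hvv hxx hxv
  rw [act_smul, hfix] at hAx
  have : (μ - 1) • c • v = 0 := by rw [sub_smul, one_smul, ← hAx, sub_self]
  exact hx ((smul_eq_zero.1 this).resolve_left (sub_ne_zero.2 hμ.1))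

/-- Isometries in `SO⁰(2,1)` map future-pointing null vectors to future-pointing ones, as these are
limits of future-pointing timelike vectors. -/
lemma act_future_null (A : SO21) {x : R21} (hx : lorentz x x = 0) (h2 : 0 < x 2) :
    0 < act A x 2 := by
  have h0 : ∀ ε : ℝ, 0 < ε → 0 ≤ act A x 2 + ε * act A (Pi.single 2 1) 2 := by
    intro ε hε
    have hft : IsFutureTimelike (x + ε • (Pi.single 2 1 : R21)) := by
      simp only [lorentz] at hx
      refine ⟨?_, ?_⟩
      · simp [lorentz]; nlinarith
      · simp; positivity
    have h := (A.2.2 _ hft).2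
    change 0 < act A _ 2 at h
    rw [act_add, act_smul] at h
    simpa using h.le
  have h1 : 0 ≤ act A x 2 := by
    by_contra! hneg
    rcases le_or_gt (act A (Pi.single 2 1) 2) 0 with hm | hm
    · have := h0 1 one_pos
      linarith
    · have := h0 (-(act A x 2) / (2 * act A (Pi.single 2 1) 2)) (by
        apply div_pos <;> linarith)
      have h3 : -(act A x 2) / (2 * act A (Pi.single 2 1) 2) * act A (Pi.single 2 1) 2
          = -(act A x 2) / 2 := by field_simp
      rw [h3] at this
      linarith
  refine lt_of_le_of_ne h1 fun h => ?_
  have hn : lorentz (act A x) (act A x) = 0 := by rw [lorentz_act, hx]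
  have hz : act A x = 0 := by
    generalize act A x = y at hn h
    simp only [lorentz, ← h] at hn
    have h0 : y 0 = 0 := by nlinarith [sq_nonneg (y 0), sq_nonneg (y 1)]
    have h1 : y 1 = 0 := by nlinarith [sq_nonneg (y 0), sq_nonneg (y 1)]
    ext i; fin_cases i <;> simp [h0, h1, ← h]
  have := act_inv_act A x
  rw [hz, act_zero] at this
  simp [← this] at h2

/-! ### Frames of hyperbolic elements -/

lemma det_of_rows (x y z : R21) : (Matrix.of ![x, y, z]).det =
    x 0 * (y 1 * z 2 - y 2 * z 1) - x 1 * (y 0 * z 2 - y 2 * z 0)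
      + x 2 * (y 0 * z 1 - y 1 * z 0) := by
  rw [Matrix.det_fin_three]; simp; ring

lemma det_of_rows_act (A : SO21) (x y z : R21) :
    (Matrix.of ![act A x, act A y, act A z]).det = (Matrix.of ![x, y, z]).det := by
  have h : Matrix.of ![act A x, act A y, act A z] = Matrix.of ![x, y, z] * A.1.1ᵀ := by
    ext i j
    fin_cases i <;>
      simp [act, Matrix.mul_apply, Matrix.mulVec, dotProduct, mul_comm]
  rw [h, Matrix.det_mul, Matrix.det_transpose, A.1.2, mul_one]

lemma eq_zero_of_orthogonal {x y z w : R21} (hd : (Matrix.of ![x, y, z]).det ≠ 0)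
    (hx : lorentz w x = 0) (hy : lorentz w y = 0) (hz : lorentz w z = 0) : w = 0 := by
  have h : (Matrix.of ![x, y, z]) *ᵥ ![w 0, w 1, -w 2] = 0 := by
    ext i
    fin_cases i
    · simp [Matrix.mulVec, dotProduct, Fin.sum_univ_three]
      simp only [lorentz] at hx; linarith
    · simp [Matrix.mulVec, dotProduct, Fin.sum_univ_three]
      simp only [lorentz] at hy; linarith
    · simp [Matrix.mulVec, dotProduct, Fin.sum_univ_three]
      simp only [lorentz] at hz; linarith
  have h2 := Matrix.eq_zero_of_mulVec_eq_zero hd h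
  have h0 := congrFun h2 0
  have h1 := congrFun h2 1
  have h3 := congrFun h2 2
  simp at h0 h1 h3
  ext i; fin_cases i <;> simp [h0, h1, h3]

/-- A basis of `ℝ^{2,1}` that consists of a unit spacelike vector and two null vectors that are
orthogonal to it. -/
structure IsNullBasis (v n m : R21) : Prop where
  unit : lorentz v v = 1
  null_left : lorentz n n = 0
  null_right : lorentz m m = 0
  orth_left : lorentz n v = 0
  orth_right : lorentz m v = 0
  det_ne_zero : (Matrix.of ![v, n, m]).det ≠ 0

namespace IsNullBasis

variable {v n m : R21}

lemma left_ne_zero (h : IsNullBasis v n m) : n ≠ 0 := by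
  rintro rfl
  apply h.det_ne_zero
  simp [det_of_rows]

lemma right_ne_zero (h : IsNullBasis v n m) : m ≠ 0 := by
  rintro rfl
  apply h.det_ne_zero
  simp [det_of_rows]

lemma pairing_ne_zero (h : IsNullBasis v n m) : lorentz n m ≠ 0 := fun h0 =>
  h.left_ne_zero (eq_zero_of_orthogonal h.det_ne_zero h.orth_left h.null_left h0)

lemma expand (h : IsNullBasis v n m) (x : R21) :
    x = lorentz x v • v + (lorentz x m / lorentz n m) • n + (lorentz x n / lorentz n m) • m := by
  rw [← sub_eq_zero]
  have hk := h.pairing_ne_zero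
  apply eq_zero_of_orthogonal h.det_ne_zero
  · simp [h.unit, h.orth_left, h.orth_right]
  · simp [h.null_left, lorentz_comm v n, h.orth_left, lorentz_comm m n]; field_simp; ring
  · simp [h.null_right, lorentz_comm v m, h.orth_right]; field_simp; ring

lemma null_orth (h : IsNullBasis v n m) {x : R21} (hx : lorentz x x = 0) (hxv : lorentz x v = 0) :
    (∃ c : ℝ, x = c • n) ∨ ∃ c : ℝ, x = c • m := by
  have he := h.expand x
  rw [hxv, zero_smul, zero_add] at he
  set a := lorentz x m / lorentz n m
  set c := lorentz x n / lorentz n m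
  rw [he] at hx
  simp only [lorentz_add_left, lorentz_add_right, lorentz_smul_left, lorentz_smul_right,
    h.null_left, h.null_right, lorentz_comm m n] at hx
  have h2 : a * c * lorentz n m = 0 := by linarith
  rcases mul_eq_zero.1 ((mul_eq_zero.1 h2).resolve_right h.pairing_ne_zero) with h0 | h0
  · right; exact ⟨c, by rw [h0, zero_smul, zero_add] at he; exact he⟩
  · left; exact ⟨a, by rw [h0, zero_smul, add_zero] at he; exact he⟩

lemma act_ext (h : IsNullBasis v n m) {A C : SO21} (hv : act A v = act C v)
    (hn : act A n = act C n) (hm : act A m = act C m) : A = C :=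
  SO21.ext_act fun x => by
    rw [h.expand x]
    simp only [act_add, act_smul, hv, hn, hm]

lemma swap (h : IsNullBasis v n m) : IsNullBasis v m n :=
  ⟨h.unit, h.null_right, h.null_left, h.orth_right, h.orth_left, fun h0 => h.det_ne_zero (by
    rw [det_of_rows] at h0 ⊢; linarith)⟩

lemma exists_frame (h : IsNullBasis v n m) (hn : 0 < n 2) (hm : 0 < m 2) {A : SO21} {c : ℝ}
    (hc0 : 0 < c) (hc1 : c < 1) (hv : act A v = v) (hAn : act A n = c • n)
    (hAm : act A m = c⁻¹ • m) : ∃ f, IsFrame A f := by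
  have hN : ∀ x : R21, 0 < x 2 → 0 < x 0 ^ 2 + x 1 ^ 2 + x 2 ^ 2 := fun x hx => by positivity
  set s := (√(n 0 ^ 2 + n 1 ^ 2 + n 2 ^ 2))⁻¹ with hs
  set t := (√(m 0 ^ 2 + m 1 ^ 2 + m 2 ^ 2))⁻¹ with ht
  have hs0 : 0 < s := inv_pos.2 (Real.sqrt_pos.2 (hN n hn))
  have ht0 : 0 < t := inv_pos.2 (Real.sqrt_pos.2 (hN m hm))
  have hs2 : s ^ 2 * (n 0 ^ 2 + n 1 ^ 2 + n 2 ^ 2) = 1 := by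
    rw [hs, inv_pow, Real.sq_sqrt (hN n hn).le, inv_mul_cancel₀ (hN n hn).ne']
  have ht2 : t ^ 2 * (m 0 ^ 2 + m 1 ^ 2 + m 2 ^ 2) = 1 := by
    rw [ht, inv_pow, Real.sq_sqrt (hN m hm).le, inv_mul_cancel₀ (hN m hm).ne']
  obtain ⟨e, he, hdet⟩ : ∃ e : ℝ, e ^ 2 = 1 ∧ 0 < e * (Matrix.of ![v, n, m]).det := by
    rcases lt_or_gt_of_ne h.det_ne_zero with h0 | h0
    · exact ⟨-1, by norm_num, by linarith⟩
    · exact ⟨1, by norm_num, by linarith⟩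
  refine ⟨⟨c, s • n, e • v, t • m⟩, hc0, hc1, ?_, ?_, ?_, ?_, ?_, ?_, ?_, ?_, ?_, ?_, ?_⟩
  · simp only [act_smul, hAn]; rw [smul_comm]
  · simp only [act_smul, hv]
  · simp only [act_smul, hAm]; rw [smul_comm]
  · simp [h.null_left]
  · simp [h.null_right]
  · simp only [Pi.smul_apply, smul_eq_mul]; linear_combination hs2
  · simp only [Pi.smul_apply, smul_eq_mul]; linear_combination ht2
  · exact mul_pos hs0 hn
  · exact mul_pos ht0 hm
  · simp only [lorentz_smul_left, lorentz_smul_right, h.unit]; linear_combination he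
  · have h1 : (Matrix.of ![e • v, s • n, t • m]).det
        = s * t * (e * (Matrix.of ![v, n, m]).det) := by
      simp only [det_of_rows, Pi.smul_apply, smul_eq_mul]; ring
    simp only [h1]
    positivity

end IsNullBasis

/-- The two future-pointing null directions orthogonal to a spacelike vector, explicitly. -/
lemma exists_nullBasis {v : R21} (hv : lorentz v v = 1) :
    ∃ n m : R21, IsNullBasis v n m ∧ 0 < n 2 ∧ 0 < m 2 := by
  have hv' : v 0 ^ 2 + v 1 ^ 2 = 1 + v 2 ^ 2 := by simp only [lorentz] at hv; linarith
  refine ⟨![v 0 * v 2 - v 1, v 1 * v 2 + v 0, 1 + v 2 ^ 2],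
    ![v 0 * v 2 + v 1, v 1 * v 2 - v 0, 1 + v 2 ^ 2], ⟨hv, ?_, ?_, ?_, ?_, ?_⟩, ?_, ?_⟩
  · simp [lorentz]; linear_combination (v 2 ^ 2 + 1) * hv'
  · simp [lorentz]; linear_combination (v 2 ^ 2 + 1) * hv'
  · simp [lorentz]; linear_combination (v 2) * hv'
  · simp [lorentz]; linear_combination (v 2) * hv'
  · have : (Matrix.of ![v, ![v 0 * v 2 - v 1, v 1 * v 2 + v 0, 1 + v 2 ^ 2],
        ![v 0 * v 2 + v 1, v 1 * v 2 - v 0, 1 + v 2 ^ 2]]).det = 2 * (1 + v 2 ^ 2) := by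
      rw [det_of_rows]
      simp
      linear_combination (2 : ℝ) * hv'
    rw [this]
    positivity
  · simp; positivity
  · simp; positivity

/-- A nontrivial element with a spacelike fixed vector `v` preserves both null lines orthogonal to
`v` (it cannot exchange them, as its determinant is one), so it has a frame. -/
lemma exists_frame_of_spacelike {A : SO21} (hA : A ≠ 1) {v : R21} (hv : 0 < lorentz v v)
    (hfix : act A v = v) : ∃ f, IsFrame A f := by
  wlog hunit : lorentz v v = 1 generalizing v
  · have hs : (√(lorentz v v))⁻¹ * ((√(lorentz v v))⁻¹ * lorentz v v) = 1 := by
      rw [← mul_assoc, ← mul_inv, Real.mul_self_sqrt hv.le, inv_mul_cancel₀ hv.ne']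
    refine this (v := (√(lorentz v v))⁻¹ • v) ?_ ?_ ?_
    · simp [hs]
    · simp [hfix]
    · simpa using hs
  obtain ⟨n, m, hb, hn, hm⟩ := exists_nullBasis hunit
  have hAn : lorentz (act A n) v = 0 := by rw [← hfix, lorentz_act, hb.orth_left]
  have hAm : lorentz (act A m) v = 0 := by rw [← hfix, lorentz_act, hb.orth_right]
  have hnn := hb.null_orth (x := act A n) (by rw [lorentz_act, hb.null_left]) hAn
  have hmm := hb.null_orth (x := act A m) (by rw [lorentz_act, hb.null_right]) hAm
  have hfn := act_future_null A hb.null_left hn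
  have hfm := act_future_null A hb.null_right hm
  have hdet := det_of_rows_act A v n m
  rw [hfix] at hdet
  have hd0 := hb.det_ne_zero
  have hpos : ∀ {c : ℝ} {x : R21}, 0 < (c • x) 2 → 0 < x 2 → 0 < c := fun {c x} h1 h2 =>
    pos_of_mul_pos_left h1 h2.le
  rcases hnn with ⟨c, hc⟩ | ⟨c, hc⟩ <;> rcases hmm with ⟨d, hd⟩ | ⟨d, hd⟩
  · exfalso
    apply hd0
    rw [← hdet, hc, hd, det_of_rows]; simp only [Pi.smul_apply, smul_eq_mul]; ring
  · have hc0 : 0 < c := hpos (hc ▸ hfn) hn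
    have hcd : c * d = 1 := by
      have h := lorentz_act A n m
      rw [hc, hd, lorentz_smul_left, lorentz_smul_right, ← mul_assoc] at h
      exact mul_right_cancel₀ hb.pairing_ne_zero (by rw [h, one_mul])
    have hdc : d = c⁻¹ := eq_inv_of_mul_eq_one_right hcd
    rcases lt_trichotomy c 1 with h1 | h1 | h1
    · exact hb.exists_frame hn hm hc0 h1 hfix hc (hdc ▸ hd)
    · refine absurd (hb.act_ext (C := 1) ?_ ?_ ?_) hA
      · rw [hfix, act_one]
      · rw [hc, h1, one_smul, act_one]
      · rw [hd, hdc, h1, inv_one, one_smul, act_one]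
    · refine hb.swap.exists_frame hm hn (c := d) ?_ ?_ hfix hd ?_
      · rw [hdc]; positivity
      · rw [hdc]; exact inv_lt_one_of_one_lt₀ h1
      · rw [hc, hdc, inv_inv]
  · exfalso
    have hc0 : 0 < c := hpos (hc ▸ hfn) hm
    have hd0' : 0 < d := hpos (hd ▸ hfm) hn
    have h1 : (Matrix.of ![v, act A n, act A m]).det
        = -(c * d) * (Matrix.of ![v, n, m]).det := by
      rw [hc, hd, det_of_rows, det_of_rows]; simp only [Pi.smul_apply, smul_eq_mul]; ring
    rw [h1] at hdet
    have h2 : (c * d + 1) * (Matrix.of ![v, n, m]).det = 0 := by linarith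
    rcases mul_eq_zero.1 h2 with h3 | h3
    · have := mul_pos hc0 hd0'; linarith
    · exact hd0 h3
  · exfalso
    apply hd0
    rw [← hdet, hc, hd, det_of_rows]; simp only [Pi.smul_apply, smul_eq_mul]; ring

lemma IsFrame.orth_minus {A : SO21} {f : Frame} (h : IsFrame A f) :
    lorentz f.minus f.zero = 0 := by
  have h1 := lorentz_act A f.minus f.zero
  rw [h.act_minus, h.act_zero, lorentz_smul_left] at h1
  have h2 : (1 - f.lam) * lorentz f.minus f.zero = 0 := by linarith
  exact (mul_eq_zero.1 h2).resolve_left (sub_ne_zero.2 h.lam_lt_one.ne')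

lemma IsFrame.orth_plus {A : SO21} {f : Frame} (h : IsFrame A f) :
    lorentz f.plus f.zero = 0 := by
  have h1 := lorentz_act A f.plus f.zero
  rw [h.act_plus, h.act_zero, lorentz_smul_left, inv_mul_eq_iff_eq_mul₀ h.lam_pos.ne'] at h1
  have h2 : (1 - f.lam) * lorentz f.plus f.zero = 0 := by linarith
  exact (mul_eq_zero.1 h2).resolve_left (sub_ne_zero.2 h.lam_lt_one.ne')

lemma IsFrame.nullBasis {A : SO21} {f : Frame} (h : IsFrame A f) :
    IsNullBasis f.zero f.minus f.plus :=
  ⟨h.unit_zero, h.null_minus, h.null_plus, h.orth_minus, h.orth_plus, h.det_pos.ne'⟩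

lemma IsFrame.isHyperbolic {A : SO21} {f : Frame} (h : IsFrame A f) : IsHyperbolic A := by
  have h1 : 1 < f.lam⁻¹ := (one_lt_inv₀ h.lam_pos).2 h.lam_lt_one
  have h2 := h.lam_lt_one
  refine ⟨{f.lam, 1, f.lam⁻¹}, Finset.card_eq_three.2
    ⟨_, _, _, h2.ne, (h2.trans h1).ne, h1.ne, rfl⟩, ?_⟩
  have hz : f.zero ≠ 0 := fun h0 => by simpa [h0] using h.unit_zero
  intro μ hμ
  simp only [Finset.mem_insert, Finset.mem_singleton] at hμ
  rcases hμ with rfl | rfl | rfl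
  · exact ⟨_, h.nullBasis.left_ne_zero, h.act_minus⟩
  · exact ⟨_, hz, by rw [h.act_zero, one_smul]⟩
  · exact ⟨_, h.nullBasis.right_ne_zero, h.act_plus⟩

lemma IsHyperbolic.ne_one {A : SO21} (hA : IsHyperbolic A) : A ≠ 1 := by
  rintro rfl
  have h := hA.fixed_spacelike (v := Pi.single 2 1)
    (by simp) (act_one _)
  simp [lorentz] at h
  linarith

lemma IsHyperbolic.isFrame {A : SO21} (hA : IsHyperbolic A) : IsFrame A (frame A) := by
  obtain ⟨v, hv, hfix⟩ := exists_fixed_vector A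
  exact Classical.epsilon_spec (exists_frame_of_spacelike hA.ne_one
    (hA.fixed_spacelike hv hfix) hfix)

lemma IsFrame.fixed_eq {A : SO21} {f : Frame} (h : IsFrame A f) {x : R21} (hx : act A x = x) :
    ∃ c : ℝ, x = c • f.zero := by
  have hm : lorentz x f.minus = 0 := by
    have h1 := lorentz_act A x f.minus
    rw [hx, h.act_minus, lorentz_smul_right] at h1
    have h2 : (1 - f.lam) * lorentz x f.minus = 0 := by linarith
    exact (mul_eq_zero.1 h2).resolve_left (sub_ne_zero.2 h.lam_lt_one.ne')
  have hp : lorentz x f.plus = 0 := by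
    have h1 := lorentz_act A x f.plus
    rw [hx, h.act_plus, lorentz_smul_right, inv_mul_eq_iff_eq_mul₀ h.lam_pos.ne'] at h1
    have h2 : (1 - f.lam) * lorentz x f.plus = 0 := by linarith
    exact (mul_eq_zero.1 h2).resolve_left (sub_ne_zero.2 h.lam_lt_one.ne')
  refine ⟨lorentz x f.zero, ?_⟩
  have h3 := h.nullBasis.expand x
  simpa [hm, hp] using h3

/-- A null vector orthogonal to the neutral eigenvector `X⁰` of `A` is an eigenvector of `A`. -/
lemma IsFrame.null_eigenvector {A : SO21} {f : Frame} (h : IsFrame A f) {x : R21}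
    (hx : lorentz x x = 0) (hxv : lorentz x f.zero = 0) :
    ∃ μ : ℝ, μ ≠ 0 ∧ act A x = μ • x := by
  rcases h.nullBasis.null_orth hx hxv with ⟨c, rfl⟩ | ⟨c, rfl⟩
  · exact ⟨f.lam, h.lam_pos.ne', by rw [act_smul, h.act_minus, smul_comm]⟩
  · exact ⟨f.lam⁻¹, inv_ne_zero h.lam_pos.ne', by rw [act_smul, h.act_plus, smul_comm]⟩

/-! ### Discrete groups of isometries -/

/-- A convergent sequence in a discrete group of matrices is eventually constant, since
`aₙ⁻¹ aₙ₊₁` tends to the identity. -/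
lemma eventually_eq_succ {Γ : Subgroup SO21} (hΓ : DiscreteTopology Γ) {a : ℕ → SO21}
    (ha : ∀ n, a n ∈ Γ) {M : Matrix (Fin 3) (Fin 3) ℝ}
    (hlim : Tendsto (fun n => (a n).1.1) atTop (𝓝 M)) : ∀ᶠ n in atTop, a n = a (n + 1) := by
  have hdetM : M.det = 1 := by
    refine tendsto_nhds_unique (((continuous_id.matrix_det).tendsto M).comp hlim) ?_
    simp [Function.comp_def]
  have hquot : Tendsto (fun n => (⟨(a n)⁻¹ * a (n + 1), Γ.mul_mem (Γ.inv_mem (ha n)) (ha _)⟩ : Γ))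
      atTop (𝓝 1) := by
    rw [tendsto_subtype_rng, tendsto_subtype_rng]
    refine SpecialLinearGroup.isClosedEmbedding_val.isEmbedding.isInducing.tendsto_nhds_iff.2 ?_
    have h1 : Tendsto (fun n => (a n).1.1.adjugate * (a (n + 1)).1.1) atTop
        (𝓝 (M.adjugate * M)) :=
      (((continuous_id.matrix_adjugate).tendsto M).comp hlim).mul
        (hlim.comp (tendsto_add_atTop_nat 1))
    rw [Matrix.adjugate_mul, hdetM, one_smul] at h1
    exact h1.congr fun n => rfl
  have hev := hquot.eventually (mem_nhds_discrete.2 rfl : {(1 : Γ)} ∈ 𝓝 1)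
  filter_upwards [hev] with n hn
  have h2 : (a n)⁻¹ * a (n + 1) = 1 := congrArg Subtype.val (Set.mem_singleton_iff.1 hn)
  exact inv_mul_eq_one.1 h2

lemma tendsto_matrix_of_act {a : ℕ → SO21}
    (h : ∀ x, ∃ y, Tendsto (fun n => act (a n) x) atTop (𝓝 y)) :
    ∃ M : Matrix (Fin 3) (Fin 3) ℝ, Tendsto (fun n => (a n).1.1) atTop (𝓝 M) := by
  choose y hy using h
  refine ⟨Matrix.of fun i j => y (Pi.single j 1) i, ?_⟩
  refine tendsto_pi_nhds.2 fun i => tendsto_pi_nhds.2 fun j => ?_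
  have h1 := (tendsto_pi_nhds.1 (hy (Pi.single j 1))) i
  refine h1.congr fun n => ?_
  simp [act]

/-- Two hyperbolic elements of a discrete group commute if an attracting eigenvector of one of
them is orthogonal to the neutral eigenvector of the other. Indeed, it is then an eigenvector of
both, so the conjugates `g⁻ⁿ h gⁿ` converge; thus they are eventually constant. -/
lemma commute_of_orthogonal {Γ : Subgroup SO21} (hΓ : DiscreteTopology Γ) {g h : SO21}
    (hg : g ∈ Γ) (hh : h ∈ Γ) {f f' : Frame} (hf : IsFrame g f) (hf' : IsFrame h f')
    (horth : lorentz f.plus f'.zero = 0) : g * h = h * g := by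
  obtain ⟨μ, hμ0, hμ⟩ := hf'.null_eigenvector hf.null_plus horth
  have hl0 := hf.lam_pos
  have hb := hf.nullBasis
  have hpow : Tendsto (fun n : ℕ => f.lam ^ n) atTop (𝓝 0) :=
    tendsto_pow_atTop_nhds_zero_of_lt_one hl0.le hf.lam_lt_one
  have gm : ∀ n : ℕ, act (g ^ n) f.minus = f.lam ^ n • f.minus := act_pow_smul hf.act_minus
  have gz : ∀ n : ℕ, act (g ^ n) f.zero = f.zero := fun n => by
    simpa using act_pow_smul (c := 1) (by rw [hf.act_zero, one_smul]) n
  have gp : ∀ n : ℕ, act (g ^ n) f.plus = (f.lam⁻¹) ^ n • f.plus := act_pow_smul hf.act_plus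
  have gm' : ∀ n : ℕ, act (g ^ n)⁻¹ f.minus = (f.lam ^ n)⁻¹ • f.minus := fun n =>
    act_inv_smul (pow_ne_zero n hl0.ne') (gm n)
  have gz' : ∀ n : ℕ, act (g ^ n)⁻¹ f.zero = f.zero := fun n => act_inv_eq_iff.2 (gz n).symm
  have gp' : ∀ n : ℕ, act (g ^ n)⁻¹ f.plus = f.lam ^ n • f.plus := fun n => by
    rw [act_inv_smul (pow_ne_zero n (inv_ne_zero hl0.ne')) (gp n), inv_pow, inv_inv]
  have key : ∀ x : R21, ∃ y, Tendsto (fun n => act ((g ^ n)⁻¹ * h * g ^ n) x) atTop (𝓝 y) := by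
    have hp : Tendsto (fun n => act ((g ^ n)⁻¹ * h * g ^ n) f.plus) atTop (𝓝 (μ • f.plus)) := by
      refine tendsto_const_nhds.congr fun n => ?_
      rw [act_mul, act_mul, gp, act_smul, act_smul, hμ, act_smul, gp', smul_comm μ, smul_smul,
        inv_pow, inv_mul_cancel₀ (pow_ne_zero n hl0.ne'), one_smul]
    have hz : ∃ y, Tendsto (fun n => act ((g ^ n)⁻¹ * h * g ^ n) f.zero) atTop (𝓝 y) := by
      have he := hb.expand (act h f.zero)
      have h0 : lorentz (act h f.zero) f.plus = 0 := by
        have h1 := lorentz_act h f.zero f.plus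
        rw [hμ, lorentz_smul_right, lorentz_comm f.zero, hf.orth_plus] at h1
        exact (mul_eq_zero.1 h1).resolve_left hμ0
      rw [h0, zero_div, zero_smul, add_zero] at he
      set r := lorentz (act h f.zero) f.zero
      set c := lorentz (act h f.zero) f.minus / lorentz f.minus f.plus
      refine ⟨r • f.zero + c • (0 : ℝ) • f.plus, ?_⟩
      refine (tendsto_const_nhds.add ((hpow.smul_const f.plus).const_smul c)).congr fun n => ?_
      rw [act_mul, act_mul, gz, he, act_add, act_smul, act_smul, gz', gp']
    have hm : ∃ y, Tendsto (fun n => act ((g ^ n)⁻¹ * h * g ^ n) f.minus) atTop (𝓝 y) := by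
      have he := hb.expand (act h f.minus)
      set r := lorentz (act h f.minus) f.zero
      set d := lorentz (act h f.minus) f.plus / lorentz f.minus f.plus
      set c := lorentz (act h f.minus) f.minus / lorentz f.minus f.plus
      refine ⟨r • (0 : ℝ) • f.zero + d • f.minus + c • ((0 : ℝ) * 0) • f.plus, ?_⟩
      refine ((((hpow.smul_const f.zero).const_smul r).add tendsto_const_nhds).add
        (((hpow.mul hpow).smul_const f.plus).const_smul c)).congr fun n => ?_
      rw [act_mul, act_mul, gm, act_smul, act_smul, he]
      simp only [act_add, act_smul, gz', gp', gm', smul_add, smul_smul]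
      have hn := pow_ne_zero n hl0.ne'
      match_scalars <;> field_simp
    intro x
    obtain ⟨yz, hz⟩ := hz
    obtain ⟨ym, hm⟩ := hm
    rw [hb.expand x]
    simp only [act_add, act_smul]
    exact ⟨_, ((hz.const_smul _).add (hm.const_smul _)).add (hp.const_smul _)⟩
  obtain ⟨M, hM⟩ := tendsto_matrix_of_act key
  obtain ⟨n, hn⟩ := (eventually_eq_succ hΓ
    (fun n => Γ.mul_mem (Γ.mul_mem (Γ.inv_mem (Γ.pow_mem hg n)) hh) (Γ.pow_mem hg n)) hM).exists
  rw [pow_succ'] at hn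
  have h2 : h = g⁻¹ * h * g := by
    have h3 : (g ^ n)⁻¹ * h * g ^ n = (g ^ n)⁻¹ * (g⁻¹ * h * g) * g ^ n :=
      hn.trans (by simp only [_root_.mul_inv_rev, mul_assoc])
    exact mul_left_cancel (mul_right_cancel h3)
  calc g * h = g * (g⁻¹ * h * g) := by rw [← h2]
    _ = h * g := by group

/-! ### Displacement of points of the hyperbolic plane -/

/-- Points of the hyperbolic plane, `-B(x, y)` being the hyperbolic cosine of the distance. -/
def InHyp (x : R21) : Prop := lorentz x x = -1 ∧ 0 < x 2

lemma InHyp.act {x : R21} (hx : InHyp x) (A : SO21) : InHyp (act A x) := act_mem_hyp A ⟨x, hx⟩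

lemma InHyp.one_le {x : R21} (hx : InHyp x) : 1 ≤ x 2 := by
  obtain ⟨h1, h2⟩ := hx
  simp only [lorentz] at h1
  nlinarith [sq_nonneg (x 0), sq_nonneg (x 1)]

lemma InHyp.eq_of_le {x y : R21} (hx : InHyp x) (hy : InHyp y) (h : -lorentz x y ≤ 1) : x = y := by
  have hx1 := hx.one_le
  have hy1 := hy.one_le
  have hxx := hx.1
  have hyy := hy.1
  simp only [lorentz] at h hxx hyy
  have h1 : (x 2 * y 2 - 1) ^ 2 ≤ (x 0 * y 0 + x 1 * y 1) ^ 2 :=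
    pow_le_pow_left₀ (by nlinarith) (by linarith) 2
  have h2 : (x 0 * y 0 + x 1 * y 1) ^ 2 ≤ (x 2 ^ 2 - 1) * (y 2 ^ 2 - 1) := by
    have e1 : x 2 ^ 2 - 1 = x 0 ^ 2 + x 1 ^ 2 := by linarith
    have e2 : y 2 ^ 2 - 1 = y 0 ^ 2 + y 1 ^ 2 := by linarith
    rw [e1, e2]
    nlinarith [sq_nonneg (x 0 * y 1 - x 1 * y 0)]
  have h3 : (x 2 - y 2) ^ 2 ≤ 0 := by nlinarith
  have h4 : x 2 = y 2 := by nlinarith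
  have h5 : (x 0 - y 0) ^ 2 + (x 1 - y 1) ^ 2 ≤ 0 := by rw [h4] at *; nlinarith
  have h6 : x 0 = y 0 := by nlinarith [sq_nonneg (x 0 - y 0), sq_nonneg (x 1 - y 1)]
  have h7 : x 1 = y 1 := by nlinarith [sq_nonneg (x 0 - y 0), sq_nonneg (x 1 - y 1)]
  ext i; fin_cases i <;> assumption

lemma InHyp.height_le {x y : R21} (hx : InHyp x) (hy : InHyp y) :
    y 2 ≤ 2 * x 2 * -lorentz x y := by
  have hx1 := hx.one_le
  have hy1 := hy.one_le
  have hxx := hx.1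
  have hyy := hy.1
  simp only [lorentz] at hxx hyy ⊢
  have h2 : (x 0 * y 0 + x 1 * y 1) ^ 2 ≤ (x 2 ^ 2 - 1) * y 2 ^ 2 := by
    have e1 : x 2 ^ 2 - 1 = x 0 ^ 2 + x 1 ^ 2 := by linarith
    have e2 : y 2 ^ 2 = y 0 ^ 2 + y 1 ^ 2 + 1 := by linarith
    rw [e1, e2]
    nlinarith [sq_nonneg (x 0 * y 1 - x 1 * y 0), sq_nonneg (x 0), sq_nonneg (x 1)]
  have h3 : (2 * x 2 * (x 0 * y 0 + x 1 * y 1)) ^ 2 ≤ (y 2 * (2 * x 2 ^ 2 - 1)) ^ 2 := by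
    calc (2 * x 2 * (x 0 * y 0 + x 1 * y 1)) ^ 2
        = 4 * x 2 ^ 2 * (x 0 * y 0 + x 1 * y 1) ^ 2 := by ring
      _ ≤ 4 * x 2 ^ 2 * ((x 2 ^ 2 - 1) * y 2 ^ 2) := by gcongr
      _ ≤ (y 2 * (2 * x 2 ^ 2 - 1)) ^ 2 := by nlinarith [sq_nonneg (y 2)]
  have h4 := (abs_le.1 (abs_le_of_sq_le_sq h3 (by
    apply mul_nonneg <;> nlinarith))).2
  nlinarith

lemma inHyp_basepoint : InHyp (Pi.single 2 1) := by
  constructor <;> simp [lorentz]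

lemma abs_entry_le (A : SO21) (i j : Fin 3) : |A.1.1 i j| ≤ A.1.1 2 2 := by
  have hcol : ∀ i j, A.1.1 i j = act A (Pi.single j 1) i := fun i j => by simp [act]
  have h2 := inHyp_basepoint.act A
  have hr := h2.one_le
  have hlen : ∀ j, (A.1.1 0 j) ^ 2 ≤ A.1.1 2 2 ^ 2 ∧ (A.1.1 1 j) ^ 2 ≤ A.1.1 2 2 ^ 2 ∧
      (A.1.1 2 j) ^ 2 ≤ A.1.1 2 2 ^ 2 := by
    intro j
    simp only [hcol]
    have h22 := h2.1
    by_cases hj : j = 2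
    · subst hj
      generalize act A (Pi.single 2 1) = y at *
      simp only [lorentz] at h22
      refine ⟨?_, ?_, le_rfl⟩ <;> nlinarith [sq_nonneg (y 0), sq_nonneg (y 1)]
    · have hjj : lorentz (act A (Pi.single j 1)) (act A (Pi.single j 1)) = 1 := by
        rw [lorentz_act]; fin_cases j <;> simp_all [lorentz]
      have hj2 : lorentz (act A (Pi.single j 1)) (act A (Pi.single 2 1)) = 0 := by
        rw [lorentz_act]; fin_cases j <;> simp_all [lorentz]
      generalize act A (Pi.single 2 1) = y at *
      generalize act A (Pi.single j 1) = x at *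
      simp only [lorentz] at h22 hjj hj2
      have h3 : (x 2 * y 2) ^ 2 ≤ (1 + x 2 ^ 2) * (y 2 ^ 2 - 1) := by
        have e0 : x 2 * y 2 = x 0 * y 0 + x 1 * y 1 := by linarith
        have e1 : 1 + x 2 ^ 2 = x 0 ^ 2 + x 1 ^ 2 := by linarith
        have e2 : y 2 ^ 2 - 1 = y 0 ^ 2 + y 1 ^ 2 := by linarith
        rw [e0, e1, e2]
        nlinarith [sq_nonneg (x 0 * y 1 - x 1 * y 0)]
      refine ⟨?_, ?_, ?_⟩ <;> nlinarith [sq_nonneg (x 0), sq_nonneg (x 1)]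
  have hpos : 0 ≤ A.1.1 2 2 := by rw [hcol]; linarith
  obtain ⟨a, b, c⟩ := hlen j
  fin_cases i
  · exact abs_le_of_sq_le_sq a hpos
  · exact abs_le_of_sq_le_sq b hpos
  · exact abs_le_of_sq_le_sq c hpos

/-- Isometries that move some point of bounded height by a bounded distance have bounded
entries. -/
lemma abs_entry_le_of_displacement {A : SO21} {z : R21} (hz : InHyp z) {R : ℝ} (hR : z 2 ≤ R)
    (hd : -lorentz z (act A z) ≤ 2) (i j : Fin 3) : |A.1.1 i j| ≤ 8 * R ^ 2 := by
  refine (abs_entry_le A i j).trans ?_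
  have h1 := hz.height_le (hz.act A)
  have h2 := (hz.act A).height_le (inHyp_basepoint.act A)
  rw [lorentz_act] at h2
  have h3 : lorentz z (Pi.single 2 1) = -z 2 := by simp [lorentz]
  have h4 : act A (Pi.single 2 1) 2 = A.1.1 2 2 := by simp [act]
  rw [h3, neg_neg, h4] at h2
  have hz1 := hz.one_le
  have hA1 := (hz.act A).one_le
  have h5 : act A z 2 ≤ 4 * R := by nlinarith
  have hR0 : 0 ≤ R := by linarith
  calc A.1.1 2 2 ≤ 2 * act A z 2 * z 2 := h2
    _ ≤ 2 * (4 * R) * R := by gcongr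
    _ = 8 * R ^ 2 := by ring

/-- Sequences of group elements with bounded displacement of points of bounded height
subconverge. -/
lemma exists_subseq {a : ℕ → SO21} {z : ℕ → R21} (hz : ∀ n, InHyp (z n)) {R : ℝ}
    (hR : ∀ n, z n 2 ≤ R) (hd : ∀ n, -lorentz (z n) (act (a n) (z n)) ≤ 2) :
    ∃ (M : Matrix (Fin 3) (Fin 3) ℝ) (w : R21) (φ : ℕ → ℕ), StrictMono φ ∧
      Tendsto (fun n => (a (φ n)).1.1) atTop (𝓝 M) ∧ Tendsto (fun n => z (φ n)) atTop (𝓝 w) := by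
  have hK : IsCompact ((Set.univ.pi fun _ => Set.univ.pi fun _ => Set.Icc (-(8 * R ^ 2)) (8 * R ^ 2)
      : Set (Fin 3 → Fin 3 → ℝ)) ×ˢ (Set.univ.pi fun _ => Set.Icc (-R) R : Set R21)) :=
    (isCompact_univ_pi fun _ => isCompact_univ_pi fun _ => isCompact_Icc).prod
      (isCompact_univ_pi fun _ => isCompact_Icc)
  obtain ⟨p, -, φ, hφ, hlim⟩ := hK.tendsto_subseq
    (x := fun n => ((fun i j => (a n).1.1 i j : Fin 3 → Fin 3 → ℝ), z n)) (fun n => by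
      refine ⟨fun i _ j _ => abs_le.1 (abs_entry_le_of_displacement (hz n) (hR n) (hd n) i j),
        fun i _ => abs_le.1 ?_⟩
      have h1 := (hz n).1
      have h2 := (hz n).2
      have h3 := hR n
      simp only [lorentz] at h1
      have hR0 : 0 ≤ R := h2.le.trans h3
      refine abs_le_of_sq_le_sq ?_ hR0
      fin_cases i <;> simp <;> nlinarith [sq_nonneg (z n 0), sq_nonneg (z n 1)])
  exact ⟨p.1, p.2, φ, hφ, (continuous_fst.tendsto p).comp hlim, (continuous_snd.tendsto p).comp hlim⟩

/-- A discrete torsion-free group acts freely on the hyperbolic plane. -/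
lemma eq_one_of_fixed {Γ : Subgroup SO21} (hΓ : DiscreteTopology Γ)
    (htf : ∀ A ∈ Γ, A ≠ 1 → ∀ n : ℕ, n ≠ 0 → A ^ n ≠ 1) {A : SO21} (hA : A ∈ Γ) {z : R21}
    (hz : InHyp z) (hfix : act A z = z) : A = 1 := by
  by_contra hne
  have hpow : ∀ n : ℕ, act (A ^ n) z = z := fun n => by
    simpa using act_pow_smul (c := 1) (by rw [hfix, one_smul]) n
  obtain ⟨M, -, φ, hφ, hM, -⟩ := exists_subseq (a := fun n => A ^ n) (z := fun _ => z)
    (fun _ => hz) (R := z 2) (fun _ => le_rfl) (fun n => by rw [hpow, hz.1]; norm_num)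
  obtain ⟨n, hn⟩ := (eventually_eq_succ hΓ (a := fun n => A ^ φ n)
    (fun n => Γ.pow_mem hA _) hM).exists
  have hlt : φ n < φ (n + 1) := hφ (Nat.lt_succ_self n)
  apply htf A hA hne (φ (n + 1) - φ n) (by omega)
  have h1 : A ^ φ n * A ^ (φ (n + 1) - φ n) = A ^ φ n * 1 := by
    rw [← pow_add, Nat.add_sub_cancel' hlt.le, mul_one, hn]
  exact mul_left_cancel h1

/-- The nontrivial elements of a discrete torsion-free group move all points of a bounded region
by at least some positive distance. -/
lemma exists_displacement_bound {Γ : Subgroup SO21} (hΓ : DiscreteTopology Γ)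
    (htf : ∀ A ∈ Γ, A ≠ 1 → ∀ n : ℕ, n ≠ 0 → A ^ n ≠ 1) (R : ℝ) :
    ∃ δ > 0, ∀ A ∈ Γ, A ≠ 1 → ∀ z, InHyp z → z 2 ≤ R → 1 + δ ≤ -lorentz z (act A z) := by
  by_contra! hcon
  have hpos : ∀ n : ℕ, (0 : ℝ) < 1 / (n + 1 : ℝ) := fun n => by positivity
  choose a haΓ ha1 z hz hzR hd using fun n : ℕ => hcon (1 / (n + 1 : ℝ)) (hpos n)
  obtain ⟨M, w, φ, hφ, hM, hw⟩ := exists_subseq hz hzR (fun n => (hd n).le.trans (by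
    have h1 : (1 : ℝ) / (n + 1 : ℝ) ≤ 1 := by
      rw [div_le_one (by positivity)]; linarith [n.cast_nonneg (α := ℝ)]
    linarith))
  obtain ⟨N, hN⟩ := eventually_atTop.1
    (eventually_eq_succ hΓ (a := fun n => a (φ n)) (fun n => haΓ _) hM)
  set A := a (φ N)
  have hconst : ∀ n ≥ N, a (φ n) = A := fun n hn => by
    induction n, hn using Nat.le_induction with
    | base => rfl
    | succ n hn ih => rw [← hN n hn, ih]
  have hcont : Continuous (act A) := Continuous.matrix_mulVec continuous_const continuous_id
  have hwH : InHyp w := by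
    have h1 : lorentz w w = -1 := by
      refine tendsto_nhds_unique ((continuous_lorentz.tendsto (w, w)).comp (hw.prodMk_nhds hw)) ?_
      simp only [Function.comp_def, (hz _).1, tendsto_const_nhds]
    have h2 : 1 ≤ w 2 := ge_of_tendsto' ((tendsto_pi_nhds.1 hw) 2) fun n => (hz _).one_le
    exact ⟨h1, by linarith⟩
  have hle : -lorentz w (act A w) ≤ 1 := by
    have h1 : Tendsto (fun n => -lorentz (z (φ n)) (act A (z (φ n)))) atTop
        (𝓝 (-lorentz w (act A w))) :=
      ((continuous_lorentz.tendsto (w, act A w)).comp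
        (hw.prodMk_nhds ((hcont.tendsto w).comp hw))).neg
    have h2 : Tendsto (fun n : ℕ => 1 + 1 / ((φ n : ℝ) + 1)) atTop (𝓝 (1 + 0)) :=
      tendsto_const_nhds.add (tendsto_one_div_add_atTop_nhds_zero_nat.comp hφ.tendsto_atTop)
    rw [add_zero] at h2
    refine le_of_tendsto_of_tendsto h1 h2 ?_
    filter_upwards [eventually_ge_atTop N] with n hn
    have h3 := (hd (φ n)).le
    rwa [hconst n hn] at h3
  exact ha1 (φ N) (eq_one_of_fixed hΓ htf (haΓ _) hwH (hwH.eq_of_le (hwH.act A) hle).symm)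

/-! ### Continuous logarithms on the hyperbolic plane -/

@[simp] lemma Hyp.smul_val (A : SO21) (x : Hyp) : (A • x).1 = act A x.1 := rfl

/-- The point of the hyperbolic plane over a point of the horizontal coordinate plane. -/
def Hyp.ofPlane (p : ℝ × ℝ) : Hyp :=
  ⟨![p.1, p.2, √(1 + p.1 ^ 2 + p.2 ^ 2)], by
    have h : 0 < 1 + p.1 ^ 2 + p.2 ^ 2 := by positivity
    refine ⟨?_, by simpa using h⟩
    simp only [lorentz, Matrix.cons_val_zero, Matrix.cons_val_one, Matrix.cons_val]
    rw [Real.mul_self_sqrt h.le]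
    ring⟩

lemma Hyp.continuous_ofPlane : Continuous Hyp.ofPlane := by
  refine Continuous.subtype_mk (continuous_pi fun i => ?_) _
  fin_cases i
  · exact continuous_fst
  · exact continuous_snd
  · exact Real.continuous_sqrt.comp (by fun_prop)

lemma Hyp.ofPlane_coord (x : Hyp) : Hyp.ofPlane (x.1 0, x.1 1) = x := by
  refine Subtype.ext ?_
  have h1 := x.2.1
  have h2 := x.2.2
  simp only [lorentz] at h1
  have h3 : √(1 + x.1 0 ^ 2 + x.1 1 ^ 2) = x.1 2 := by
    rw [show 1 + x.1 0 ^ 2 + x.1 1 ^ 2 = x.1 2 ^ 2 by linarith, Real.sqrt_sq h2.le]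
  ext i
  fin_cases i
  · rfl
  · rfl
  · exact h3

lemma Hyp.continuous_val : Continuous fun x : Hyp => x.1 := continuous_subtype_val

instance : PreconnectedSpace Hyp where
  isPreconnected_univ := by
    have h : Function.Surjective Hyp.ofPlane := fun x => ⟨_, Hyp.ofPlane_coord x⟩
    rw [← h.range_eq]
    exact isPreconnected_range Hyp.continuous_ofPlane

instance : ContinuousConstSMul SO21 Hyp where
  continuous_const_smul _ := Continuous.subtype_mk
    (Continuous.matrix_mulVec continuous_const Hyp.continuous_val) _

/-- Continuous functions without zeros on the hyperbolic plane have continuous logarithms, as the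
hyperbolic plane is simply connected. -/
lemma exists_continuous_log {F : Hyp → ℂ} (hF : Continuous F) (h0 : ∀ x, F x ≠ 0) :
    ∃ l : Hyp → ℂ, Continuous l ∧ ∀ x, Complex.exp (l x) = F x := by
  let G : C(ℝ × ℝ, {z : ℂ // z ≠ 0}) :=
    ⟨fun p => ⟨F (Hyp.ofPlane p), h0 _⟩, (hF.comp Hyp.continuous_ofPlane).subtype_mk _⟩
  obtain ⟨l, ⟨-, hl⟩, -⟩ := Complex.isCoveringMap_exp.existsUnique_continuousMap_lifts G (0, 0)
    (Complex.log (F (Hyp.ofPlane (0, 0)))) (Subtype.ext (Complex.exp_log (h0 _)))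
  refine ⟨fun x => l (x.1 0, x.1 1), l.continuous.comp ?_, fun x => ?_⟩
  · exact ((continuous_apply 0).comp Hyp.continuous_val).prodMk
      ((continuous_apply 1).comp Hyp.continuous_val)
  · have h := congrArg Subtype.val (congrFun hl (x.1 0, x.1 1))
    simpa [G, Hyp.ofPlane_coord] using h

/-- Two continuous logarithms of a function on a connected space differ by a constant. -/
lemma log_sub_eq {X : Type*} [TopologicalSpace X] [PreconnectedSpace X] {l l' : X → ℂ}
    (hl : Continuous l) (hl' : Continuous l') (h : ∀ x, Complex.exp (l x) = Complex.exp (l' x))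
    (x y : X) : l x - l y = l' x - l' y := by
  have hy : Complex.exp (l y - l' y) = 1 := by
    rw [Complex.exp_sub, h, div_self (Complex.exp_ne_zero _)]
  have := Complex.isCoveringMap_exp.eq_of_comp_eq (g₁ := l) (g₂ := fun z => l' z + (l y - l' y))
    hl (hl'.add continuous_const)
    (funext fun z => Subtype.ext (by simp [Complex.exp_add, hy, h])) y (by simp)
  rw [congrFun this x]
  ring

/-! ### Winding numbers of the elements of the group around the punctures -/

/-- The data of `IsFuchsianHolonomy.uniformizes`: the projection `q` of the hyperbolic plane to the
complex plane whose image is the sphere with holes and whose fibres are the orbits of the group.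
Compact subsets of the surface are covered by points of bounded height. -/
structure IsUniformization {b : ℕ} (ρ : FreeGroup (Fin b) →* SO21) (q : Hyp → ℂ) (x₀ : Hyp) :
    Prop where
  continuous : Continuous q
  ne_puncture : ∀ x (k : Fin b), q x ≠ ((k.1 : ℕ) : ℂ)
  eq_iff : ∀ x y, q x = q y ↔ ∃ g, ρ g • x = y
  compact_cover : ∀ K : Set ℂ, IsCompact K → (∀ z ∈ K, ∀ k : Fin b, z ≠ ((k.1 : ℕ) : ℂ)) →
    ∃ R : ℝ, ∀ z ∈ K, ∃ x : Hyp, x.1 2 ≤ R ∧ q x = z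
  lift_stdLoop : ∀ k : Fin b, ∃ c : Path x₀ (ρ (FreeGroup.of k) • x₀),
    ∀ t : unitInterval, q (c t) = stdLoop k.1 t.1

lemma IsFuchsianHolonomy.exists_uniformization {b : ℕ} {ρ : FreeGroup (Fin b) →* SO21}
    (hρ : IsFuchsianHolonomy b ρ) : ∃ q x₀, IsUniformization ρ q x₀ := by
  obtain ⟨Ψ, x₀, hloop⟩ := hρ.uniformizes
  have : ContinuousConstSMul ρ.range Hyp := ⟨fun A => continuous_const_smul A.1⟩
  have hmk := MulAction.isOpenQuotientMap_quotientMk (Γ := ρ.range) (T := Hyp)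
  let p : Hyp → Surface b := fun x => Ψ (Quotient.mk _ x)
  have hpc : Continuous p := Ψ.continuous.comp hmk.continuous
  have hpo : IsOpenMap p := Ψ.isOpenMap.comp hmk.isOpenMap
  have hps : Function.Surjective p := Ψ.surjective.comp hmk.surjective
  refine ⟨fun x => (p x : ℂ), x₀, continuous_subtype_val.comp hpc, fun x k => (p x).2 k, ?_, ?_,
    hloop⟩
  · intro x y
    rw [Subtype.val_injective.eq_iff, Ψ.injective.eq_iff, Quotient.eq]
    rw [MulAction.orbitRel_apply]
    constructor
    · rintro ⟨⟨_, g, rfl⟩, hg⟩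
      refine ⟨g⁻¹, ?_⟩
      rw [map_inv, inv_smul_eq_iff]
      exact hg.symm
    · rintro ⟨g, rfl⟩
      refine ⟨⟨ρ g⁻¹, g⁻¹, rfl⟩, ?_⟩
      change ρ g⁻¹ • ρ g • x = x
      rw [map_inv, inv_smul_smul]
  · intro K hK hKne
    have hval : Topology.IsInducing (fun z : Surface b => (z : ℂ)) :=
      Topology.IsInducing.subtypeVal
    have hK' : IsCompact ((fun z : Surface b => (z : ℂ)) ⁻¹' K) := by
      refine hval.isCompact_iff.2 ?_
      rwa [Set.image_preimage_eq_of_subset fun z hz => ⟨⟨z, hKne z hz⟩, rfl⟩]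
    have hU : ∀ n : ℕ, IsOpen (p '' {x : Hyp | x.1 2 < n}) := fun n =>
      hpo _ (isOpen_lt ((continuous_apply 2).comp Hyp.continuous_val) continuous_const)
    obtain ⟨n, hn⟩ := hK'.elim_directed_cover _ hU (fun z _ => by
        obtain ⟨x, rfl⟩ := hps z
        obtain ⟨n, hn⟩ := exists_nat_gt (x.1 2)
        exact Set.mem_iUnion.2 ⟨n, x, hn, rfl⟩)
      (Monotone.directed_le fun m n hmn => Set.image_mono fun x (hx : x.1 2 < m) =>
        show x.1 2 < n from lt_of_lt_of_le hx (Nat.cast_le.2 hmn))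
    refine ⟨n, fun z hz => ?_⟩
    obtain ⟨x, hx, hxz⟩ := hn (show (⟨z, hKne z hz⟩ : Surface b) ∈
      (fun z : Surface b => (z : ℂ)) ⁻¹' K from hz)
    exact ⟨x, le_of_lt hx, congrArg Subtype.val hxz⟩

/-- `w` is (`2πi` times) the winding number of the elements of the group around the `k`-th
puncture: the period of the logarithm of `z - k`, lifted to the hyperbolic plane. -/
structure IsWinding {b : ℕ} (ρ : FreeGroup (Fin b) →* SO21) (q : Hyp → ℂ) (k : Fin b)
    (w : FreeGroup (Fin b) → ℂ) : Prop where
  exists_log : ∃ l : Hyp → ℂ, Continuous l ∧ (∀ x, Complex.exp (l x) = q x - (k.1 : ℕ)) ∧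
    ∀ g x, l (ρ g • x) = l x + w g

lemma IsUniformization.exists_winding {b : ℕ} {ρ : FreeGroup (Fin b) →* SO21} {q : Hyp → ℂ}
    {x₀ : Hyp} (hq : IsUniformization ρ q x₀) (k : Fin b) : ∃ w, IsWinding ρ q k w := by
  obtain ⟨l, hl, hexp⟩ := exists_continuous_log (F := fun x => q x - (k.1 : ℕ))
    (hq.continuous.sub continuous_const) (fun x => sub_ne_zero.2 (hq.ne_puncture x k))
  refine ⟨fun g => l (ρ g • x₀) - l x₀, l, hl, hexp, fun g x => ?_⟩
  have h := log_sub_eq (l := fun x => l (ρ g • x)) (l' := l) (hl.comp (continuous_const_smul _)) hl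
    (fun x => by rw [hexp, hexp, ← (hq.eq_iff x _).2 ⟨g, rfl⟩]) x x₀
  linear_combination h

namespace IsWinding

variable {b : ℕ} {ρ : FreeGroup (Fin b) →* SO21} {q : Hyp → ℂ} {x₀ : Hyp} {k : Fin b}
  {w : FreeGroup (Fin b) → ℂ}

lemma map_mul (hw : IsWinding ρ q k w) (x₀ : Hyp) (g h : FreeGroup (Fin b)) :
    w (g * h) = w g + w h := by
  obtain ⟨l, -, -, hlw⟩ := hw.exists_log
  have h1 := hlw (g * h) x₀
  rw [_root_.map_mul, mul_smul, hlw, hlw] at h1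
  linear_combination -h1

lemma map_one (hw : IsWinding ρ q k w) (x₀ : Hyp) : w 1 = 0 := by
  have h := hw.map_mul x₀ 1 1
  rw [mul_one] at h
  linear_combination -h

lemma map_inv (hw : IsWinding ρ q k w) (x₀ : Hyp) (g : FreeGroup (Fin b)) : w g⁻¹ = -w g := by
  have h := hw.map_mul x₀ g g⁻¹
  rw [mul_inv_cancel, hw.map_one x₀] at h
  linear_combination -h

/-- The winding number can be computed along any path in the hyperbolic plane. -/
lemma eq_of_path (hw : IsWinding ρ q k w) {g : FreeGroup (Fin b)} {x : Hyp}
    (c : Path x (ρ g • x)) {l : unitInterval → ℂ} (hl : Continuous l)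
    (hexp : ∀ t, Complex.exp (l t) = q (c t) - (k.1 : ℕ)) : w g = l 1 - l 0 := by
  obtain ⟨L, hL, hLexp, hLw⟩ := hw.exists_log
  have h := log_sub_eq (l := fun t => L (c t)) (l' := l) (hL.comp c.continuous) hl
    (fun t => by rw [hLexp, hexp]) 1 0
  rw [← h, c.target, c.source, hLw]
  ring

end IsWinding

lemma stdLoop_zero (k : ℕ) : stdLoop k 0 = Complex.I := by
  simp [stdLoop]

lemma stdLoop_one (k : ℕ) : stdLoop k 1 = Complex.I := by
  norm_num [stdLoop]

lemma stdLoop_circle {k : ℕ} {t : ℝ} (h1 : 1 / 3 < t) (h2 : t ≤ 2 / 3) : stdLoop k t =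
    (k : ℂ) + Complex.I / 3 * Complex.exp (2 * Real.pi * Complex.I * (3 * t - 1 : ℝ)) := by
  rw [stdLoop, if_neg (not_le.2 h1), if_pos h2]

/-- Outside of its middle third, the standard loop runs on straight segments in the upper
half-plane. -/
lemma stdLoop_im_pos {k : ℕ} {t : ℝ} (h : t ≤ 1 / 3 ∨ 2 / 3 < t) :
    0 < (stdLoop k t).im := by
  rcases h with h | h
  · rw [stdLoop, if_pos h]
    simp [Complex.add_im, Complex.mul_im]
    linarith
  · rw [stdLoop, if_neg (not_le.2 (by linarith)), if_neg (not_le.2 h)]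
    simp [Complex.add_im, Complex.mul_im]
    linarith

lemma slitPlane_of_im_pos {z : ℂ} (h : 0 < z.im) : -Complex.I * z ∈ Complex.slitPlane := by
  rw [Complex.mem_slitPlane_iff]
  left
  simpa using h

/-- A standard loop does not wind around the other punctures, as it stays away from the vertical
half-lines below them. -/
lemma IsWinding.stdLoop_of_ne {b : ℕ} {ρ : FreeGroup (Fin b) →* SO21} {q : Hyp → ℂ} {x₀ : Hyp}
    (hq : IsUniformization ρ q x₀) {k : Fin b} {w : FreeGroup (Fin b) → ℂ}
    (hw : IsWinding ρ q k w) {i : Fin b} (hik : i ≠ k) : w (FreeGroup.of i) = 0 := by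
  obtain ⟨c, hc⟩ := hq.lift_stdLoop i
  have hslit : ∀ t : unitInterval,
      -Complex.I * (q (c t) - (k.1 : ℕ)) ∈ Complex.slitPlane := by
    intro t
    rw [hc]
    by_cases ht : t.1 ≤ 1 / 3 ∨ 2 / 3 < t.1
    · apply slitPlane_of_im_pos
      simpa using stdLoop_im_pos ht
    · push Not at ht
      rw [Complex.mem_slitPlane_iff, stdLoop_circle ht.1 ht.2]
      right
      set e := Complex.I / 3 * Complex.exp (2 * Real.pi * Complex.I * (3 * t.1 - 1 : ℝ)) with he
      have hnorm : ‖e‖ = 1 / 3 := by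
        rw [he, show (2 * Real.pi * Complex.I * (3 * t.1 - 1 : ℝ) : ℂ)
          = ((2 * Real.pi * (3 * t.1 - 1) : ℝ) : ℂ) * Complex.I by push_cast; ring, norm_mul,
          Complex.norm_exp_ofReal_mul_I]
        simp
      have hre := Complex.abs_re_le_norm e
      rw [hnorm] at hre
      have hint : (1 : ℝ) ≤ |(i.1 : ℝ) - (k.1 : ℝ)| := by
        have h1 : (i.1 : ℤ) - (k.1 : ℤ) ≠ 0 := sub_ne_zero.2 fun h =>
          hik (Fin.ext (Int.ofNat_inj.1 h))
        have h2 : ((1 : ℤ) : ℝ) ≤ ((|(i.1 : ℤ) - (k.1 : ℤ)| : ℤ) : ℝ) :=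
          Int.cast_le.2 (Int.one_le_abs h1)
        simpa only [Int.cast_one, Int.cast_abs, Int.cast_sub, Int.cast_natCast] using h2
      simp only [neg_mul, Complex.neg_im, Complex.I_mul_im, Complex.sub_re, Complex.add_re,
        Complex.natCast_re, ne_eq, neg_eq_zero]
      intro h0
      have h1 : (i.1 : ℝ) - k.1 = -e.re := by linarith
      rw [h1, abs_neg] at hint
      linarith
  have h := hw.eq_of_path c
    (l := fun t => Complex.log (-Complex.I * (q (c t) - (k.1 : ℕ))) + Complex.log Complex.I)
    ((Continuous.clog (continuous_const.mul ((hq.continuous.comp c.continuous).sub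
      continuous_const)) hslit).add continuous_const) (fun t => by
        rw [Complex.exp_add, Complex.exp_log (Complex.slitPlane_ne_zero (hslit t)),
          Complex.exp_log Complex.I_ne_zero]
        linear_combination (-(q (c t) - (k.1 : ℕ))) * Complex.I_mul_I)
  rw [h, hc, hc]
  simp [stdLoop_zero, stdLoop_one]

/-- A standard loop winds once around its puncture: after rotating the circle back to its starting
point, it stays in a slit plane. -/
lemma IsWinding.stdLoop_self {b : ℕ} {ρ : FreeGroup (Fin b) →* SO21} {q : Hyp → ℂ} {x₀ : Hyp}
    (hq : IsUniformization ρ q x₀) {k : Fin b} {w : FreeGroup (Fin b) → ℂ}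
    (hw : IsWinding ρ q k w) : w (FreeGroup.of k) = 2 * Real.pi * Complex.I := by
  obtain ⟨c, hc⟩ := hq.lift_stdLoop k
  -- `θ` is the fraction of the circle that the loop has covered at the time `t`.
  let θ : unitInterval → ℝ := fun t => max 0 (min 1 (3 * t.1 - 1))
  have hθ : Continuous θ := by fun_prop
  let ζ : unitInterval → ℂ := fun t =>
    -Complex.I * (q (c t) - (k.1 : ℕ)) * Complex.exp (-(2 * Real.pi * Complex.I * θ t))
  have hqc : Continuous fun t => q (c t) := hq.continuous.comp c.continuous
  have hζ : Continuous ζ :=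
    (continuous_const.mul (hqc.sub continuous_const)).mul (Complex.continuous_exp.comp
      (continuous_const.mul (Complex.continuous_ofReal.comp hθ)).neg)
  have hslit : ∀ t : unitInterval, ζ t ∈ Complex.slitPlane := by
    intro t
    simp only [ζ]
    rw [hc]
    by_cases ht : t.1 ≤ 1 / 3 ∨ 2 / 3 < t.1
    · have he : Complex.exp (-(2 * Real.pi * Complex.I * θ t)) = 1 := by
        rcases ht with ht | ht
        · have : θ t = 0 := max_eq_left ((min_le_right _ _).trans (by linarith))
          simp [this]
        · have : θ t = 1 := by
            simp only [θ]
            rw [min_eq_left (by linarith)]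
            norm_num
          rw [this, Complex.ofReal_one, mul_one, Complex.exp_neg, Complex.exp_two_pi_mul_I, inv_one]
      rw [he, mul_one]
      apply slitPlane_of_im_pos
      simpa using stdLoop_im_pos ht
    · push Not at ht
      have hθt : θ t = 3 * t.1 - 1 := by
        simp only [θ]
        rw [min_eq_right (by linarith), max_eq_right (by linarith)]
      rw [stdLoop_circle ht.1 ht.2, hθt, add_sub_cancel_left, Complex.exp_neg]
      have hne := Complex.exp_ne_zero (2 * Real.pi * Complex.I * ((3 * t.1 - 1 : ℝ) : ℂ))
      have : -Complex.I * (Complex.I / 3 * Complex.exp (2 * Real.pi * Complex.I *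
          ((3 * t.1 - 1 : ℝ) : ℂ))) * (Complex.exp (2 * Real.pi * Complex.I *
          ((3 * t.1 - 1 : ℝ) : ℂ)))⁻¹ = 1 / 3 := by
        rw [mul_assoc, mul_assoc, mul_inv_cancel₀ hne]
        linear_combination (-(1 / 3) : ℂ) * Complex.I_mul_I
      rw [this, Complex.mem_slitPlane_iff]
      left
      norm_num
  have h := hw.eq_of_path c
    (l := fun t => Complex.log (ζ t) + Complex.log Complex.I + 2 * Real.pi * Complex.I * θ t)
    (by
      have := Continuous.clog hζ hslit
      fun_prop) (fun t => by
        rw [Complex.exp_add, Complex.exp_add, Complex.exp_log (Complex.slitPlane_ne_zero (hslit t)),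
          Complex.exp_log Complex.I_ne_zero]
        simp only [ζ]
        rw [Complex.exp_neg]
        have hne := Complex.exp_ne_zero (2 * Real.pi * Complex.I * (θ t : ℂ))
        field_simp
        linear_combination (-(q (c t) - (k.1 : ℕ))) * Complex.I_mul_I)
  have hθ0 : θ 0 = 0 := by simp [θ]
  have hθ1 : θ 1 = 1 := by norm_num [θ]
  have h01 : ζ 1 = ζ 0 := by
    simp only [ζ, hc, hθ0, hθ1]
    simp [stdLoop_zero, stdLoop_one, Complex.exp_neg, Complex.exp_two_pi_mul_I]
  rw [h, h01, hθ0, hθ1]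
  simp

lemma initialProd_succ {b n : ℕ} (hn : n < b) :
    initialProd b (n + 1) = initialProd b n * FreeGroup.of ⟨n, hn⟩ := by
  unfold initialProd
  rw [List.take_add_one]
  simp [hn]

lemma initialProd_zero (b : ℕ) : initialProd b 0 = 1 := by simp [initialProd]

lemma IsWinding.initialProd {b : ℕ} {ρ : FreeGroup (Fin b) →* SO21} {q : Hyp → ℂ} {x₀ : Hyp}
    (hq : IsUniformization ρ q x₀) {k : Fin b} {w : FreeGroup (Fin b) → ℂ}
    (hw : IsWinding ρ q k w) {n : ℕ} (hn : n ≤ b) :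
    w (HoledSphere.initialProd b n) = if k.1 < n then 2 * Real.pi * Complex.I else 0 := by
  induction n with
  | zero => simp [initialProd_zero, hw.map_one x₀]
  | succ n ih =>
    rw [initialProd_succ hn, hw.map_mul x₀, ih (by omega)]
    rcases lt_trichotomy k.1 n with h | h | h
    · rw [hw.stdLoop_of_ne hq (fun h' => by simp [← h'] at h), if_pos h, if_pos (by omega),
        add_zero]
    · rw [show (⟨n, hn⟩ : Fin b) = k from Fin.ext h.symm, hw.stdLoop_self hq, if_neg (by omega),
        if_pos (by omega), zero_add]
    · rw [hw.stdLoop_of_ne hq (fun h' => by simp [← h'] at h), if_neg (by omega),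
        if_neg (by omega), add_zero]

/-! ### Simple closed curves that separate the punctures are not parabolic -/

/-- A future-pointing timelike vector, scaled to a point of the hyperbolic plane. -/
def Hyp.normalize (u : R21) (hu : IsFutureTimelike u) : Hyp :=
  ⟨(√(-lorentz u u))⁻¹ • u, by
    have h : 0 < -lorentz u u := neg_pos.2 hu.1
    refine ⟨?_, mul_pos (inv_pos.2 (Real.sqrt_pos.2 h)) hu.2⟩
    rw [lorentz_smul_left, lorentz_smul_right, ← mul_assoc, ← mul_inv, Real.mul_self_sqrt h.le,
      inv_neg, neg_mul, inv_mul_cancel₀ hu.1.ne]⟩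

/-- If `A` fixes the null vector `v`, then `A` moves the points far out towards `v` by short
distances, even along whole paths from such a point `x` to `A x`: adding a large multiple of `v`
to the points of a path brings down the displacement. -/
lemma exists_short_path {A : SO21} {v : R21} (hv : v ≠ 0) (hvv : lorentz v v = 0)
    (hfix : act A v = v) {δ : ℝ} (hδ : 0 < δ) :
    ∃ (x : Hyp) (c : Path x (A • x)), ∀ t, -lorentz (c t).1 (act A (c t).1) < 1 + δ := by
  wlog hpos : 0 < v 2 generalizing v
  · refine this (v := -v) (neg_ne_zero.2 hv) (by simpa using hvv) (by simp [hfix]) ?_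
    have h0 : v 2 ≠ 0 := by
      intro h
      apply hv
      simp only [lorentz, h] at hvv
      have h0 : v 0 = 0 := by nlinarith [sq_nonneg (v 0), sq_nonneg (v 1)]
      have h1 : v 1 = 0 := by nlinarith [sq_nonneg (v 0), sq_nonneg (v 1)]
      ext i; fin_cases i <;> simp [h0, h1, h]
    have h1 : v 2 < 0 := lt_of_le_of_ne (not_lt.1 hpos) h0
    simpa using h1
  set e : R21 := Pi.single 2 1 with he
  have heH : InHyp e := inHyp_basepoint
  have hAe := heH.act A
  set D := -lorentz e (act A e) with hD
  set D₂ := -lorentz e (act A (act A e)) with hD₂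
  have hev : lorentz e v = -v 2 := by simp [he, lorentz]
  have hAev : lorentz (act A e) v = -v 2 := by rw [← hfix, lorentz_act, hev, hfix]
  have hD1 : 1 ≤ D := by
    have h1 := hAe.one_le
    have h2 : D = act A e 2 := by simp [hD, he, lorentz]
    rw [h2]; exact h1
  -- `u t` below satisfies `-B(u, A u) ≤ M + 2 s v₂` and `-B(u, u) ≥ 1 + 2 s v₂`, and `s` is chosen
  -- such that the quotient of the right-hand sides is less than `1 + δ`.
  set M := D + |D₂| + 1 with hM
  set s := (M + 1) / (2 * v 2 * δ) with hs
  have hM0 : 0 < M := by positivity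
  have hs0 : 0 < s := by positivity
  have hsδ : 2 * s * v 2 * δ = M + 1 := by rw [hs]; field_simp
  let u : ℝ → R21 := fun t => (1 - t) • e + t • act A e + s • v
  have huu : ∀ t, -lorentz (u t) (u t)
      = (1 - t) ^ 2 + t ^ 2 + 2 * (t * (1 - t)) * D + 2 * s * v 2 := fun t => by
    simp only [u, lorentz_add_left, lorentz_add_right, lorentz_smul_left, lorentz_smul_right,
      lorentz_comm (act A e) e, lorentz_comm v, hev, hAev, hvv, heH.1, hAe.1]
    rw [hD]; ring
  have huA : ∀ t, -lorentz (u t) (act A (u t))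
      = (1 - t) ^ 2 * D + t ^ 2 * D + t * (1 - t) * (D₂ + 1) + 2 * s * v 2 := fun t => by
    have h1 : lorentz e (act A v) = -v 2 := by rw [hfix, hev]
    have h2 : lorentz (act A e) (act A (act A e)) = -D := by rw [lorentz_act, hD, neg_neg]
    have h3 : lorentz v (act A (act A e)) = -v 2 := by
      rw [← hfix, lorentz_act, hfix, lorentz_comm, hAev]
    simp only [u, act_add, act_smul, hfix, lorentz_add_left, lorentz_add_right, lorentz_smul_left,
      lorentz_smul_right, lorentz_comm v (act A e), hev, hAev, hvv, hAe.1, h2, h3]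
    rw [hD, hD₂]; ring
  have hsv : 0 < s * v 2 := by positivity
  have hm : ∀ t : unitInterval, 1 + 2 * s * v 2 ≤ -lorentz (u t) (u t) := fun t => by
    have h0 := mul_nonneg t.2.1 (sub_nonneg.2 t.2.2)
    rw [huu]
    nlinarith [mul_le_mul_of_nonneg_left hD1 h0]
  have hfut : ∀ t : unitInterval, IsFutureTimelike (u t) := fun t => by
    refine ⟨by linarith [hm t], ?_⟩
    have h1 := mul_nonneg (sub_nonneg.2 t.2.2) heH.2.le
    have h2 := mul_nonneg t.2.1 hAe.2.le
    simp only [u, Pi.add_apply, Pi.smul_apply, smul_eq_mul]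
    linarith
  have hlt : ∀ t : unitInterval,
      -lorentz (u t) (act A (u t)) < (1 + δ) * -lorentz (u t) (u t) := fun t => by
    have h0 := mul_nonneg t.2.1 (sub_nonneg.2 t.2.2)
    have h1 : (1 - t.1) ^ 2 * D + t.1 ^ 2 * D ≤ D := by nlinarith
    have h2 : t.1 * (1 - t.1) * (D₂ + 1) ≤ |D₂| + 1 := by
      have h3 : t.1 * (1 - t.1) ≤ 1 := by nlinarith [t.2.1, t.2.2]
      calc t.1 * (1 - t.1) * (D₂ + 1) ≤ t.1 * (1 - t.1) * (|D₂| + 1) :=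
            mul_le_mul_of_nonneg_left (by linarith [le_abs_self D₂]) h0
        _ ≤ 1 * (|D₂| + 1) := mul_le_mul_of_nonneg_right h3 (by positivity)
        _ = _ := one_mul _
    calc -lorentz (u t) (act A (u t)) ≤ M + 2 * s * v 2 := by rw [huA]; linarith
      _ < (1 + δ) * (1 + 2 * s * v 2) := by nlinarith
      _ ≤ _ := mul_le_mul_of_nonneg_left (hm t) (by linarith)
  have hcont : Continuous fun t : unitInterval => Hyp.normalize (u t) (hfut t) := by
    refine Continuous.subtype_mk ?_ _
    have hu : Continuous fun t : unitInterval => u t := by fun_prop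
    refine Continuous.smul (Continuous.inv₀ (Real.continuous_sqrt.comp
      (continuous_lorentz.comp (hu.prodMk hu)).neg) fun t => ?_) hu
    exact (Real.sqrt_pos.2 (neg_pos.2 (hfut t).1)).ne'
  refine ⟨Hyp.normalize (u 0) (hfut 0), ⟨⟨_, hcont⟩, rfl, ?_⟩, fun t => ?_⟩
  · refine Subtype.ext ?_
    have h1 : u 1 = act A (u 0) := by simp [u, hfix]
    have h2 : lorentz (u 1) (u 1) = lorentz (u 0) (u 0) := by rw [h1, lorentz_act]
    change (√(-lorentz (u 1) (u 1)))⁻¹ • u 1 = act A ((√(-lorentz (u 0) (u 0)))⁻¹ • u 0)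
    rw [h2, h1, act_smul]
  · change -lorentz ((√(-lorentz (u t) (u t)))⁻¹ • u t)
      (act A ((√(-lorentz (u t) (u t)))⁻¹ • u t)) < 1 + δ
    have hN : 0 < -lorentz (u t) (u t) := neg_pos.2 (hfut t).1
    rw [act_smul, lorentz_smul_left, lorentz_smul_right, ← mul_assoc, ← mul_inv,
      Real.mul_self_sqrt hN.le, ← mul_neg, inv_mul_lt_iff₀ hN, mul_comm]
    exact hlt t

lemma range_torsionFree {b : ℕ} {ρ : FreeGroup (Fin b) →* SO21} (hinj : Function.Injective ρ) :
    ∀ A ∈ ρ.range, A ≠ 1 → ∀ n : ℕ, n ≠ 0 → A ^ n ≠ 1 := by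
  rintro _ ⟨g, rfl⟩ hne n hn h
  rw [← map_pow, map_eq_one_iff ρ hinj] at h
  exact hne (by rw [(pow_eq_one_iff_left hn).1 h, map_one])

/-- A loop of a parabolic element can be moved out of every compact subset of the surface, as the
group elements move the points over the compact subset by at least some positive distance. -/
lemma IsUniformization.exists_path_avoiding {b : ℕ} {ρ : FreeGroup (Fin b) →* SO21} {q : Hyp → ℂ}
    {x₀ : Hyp} (hq : IsUniformization ρ q x₀) (hinj : Function.Injective ρ)
    (hdisc : DiscreteTopology ρ.range) {g : FreeGroup (Fin b)} (hg : g ≠ 1) {v : R21}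
    (hv : v ≠ 0) (hvv : lorentz v v = 0) (hfix : act (ρ g) v = v) {K : Set ℂ} (hK : IsCompact K)
    (hKne : ∀ z ∈ K, ∀ k : Fin b, z ≠ ((k.1 : ℕ) : ℂ)) :
    ∃ (x : Hyp) (c : Path x (ρ g • x)), ∀ t, q (c t) ∉ K := by
  obtain ⟨R, hR⟩ := hq.compact_cover K hK hKne
  obtain ⟨δ, hδ, hdisp⟩ := exists_displacement_bound hdisc (range_torsionFree hinj) R
  obtain ⟨x, c, hc⟩ := exists_short_path hv hvv hfix hδ
  refine ⟨x, c, fun t ht => ?_⟩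
  obtain ⟨y, hy, hqy⟩ := hR _ ht
  obtain ⟨γ, hγ⟩ := (hq.eq_iff _ _).1 hqy.symm
  have hne : ρ (γ * g * γ⁻¹) ≠ 1 := by
    rw [Ne, map_eq_one_iff ρ hinj, conj_eq_one_iff]
    exact hg
  have h := hdisp _ ⟨_, rfl⟩ hne y.1 y.2 hy
  rw [map_mul, map_mul, map_inv, act_mul, act_mul, ← hγ, Hyp.smul_val, act_inv_act,
    lorentz_act] at h
  exact absurd (hc t) (not_lt.2 h)

/-- The loop of a parabolic element can be moved into a neighbourhood of a puncture. If the puncture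
is finite, then the loop winds around no other puncture. If it is `∞`, then the loop has the same
winding number around all finite punctures. -/
lemma IsUniformization.winding_of_parabolic {b : ℕ} {ρ : FreeGroup (Fin b) →* SO21} {q : Hyp → ℂ}
    {x₀ : Hyp} (hq : IsUniformization ρ q x₀) (hinj : Function.Injective ρ)
    (hdisc : DiscreteTopology ρ.range) {g : FreeGroup (Fin b)} (hg : g ≠ 1) {v : R21}
    (hv : v ≠ 0) (hvv : lorentz v v = 0) (hfix : act (ρ g) v = v)
    {w : Fin b → FreeGroup (Fin b) → ℂ} (hw : ∀ k, IsWinding ρ q k (w k)) :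
    (∃ k, ∀ k', k' ≠ k → w k' g = 0) ∨ ∀ k k', w k g = w k' g := by
  -- The complement of `K` is the disjoint union of small discs around the punctures and a
  -- neighbourhood of `∞`, and the loop stays in one of these parts.
  let K : Set ℂ := Metric.closedBall 0 b ∩ ⋂ k : Fin b, {z | 1 / 3 ≤ ‖z - ((k.1 : ℕ) : ℂ)‖}
  have hK : IsCompact K := (isCompact_closedBall _ _).inter_right
    (isClosed_iInter fun k => isClosed_le continuous_const (by fun_prop))
  have hKne : ∀ z ∈ K, ∀ k : Fin b, z ≠ ((k.1 : ℕ) : ℂ) := by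
    rintro z ⟨-, hz⟩ k rfl
    have h := Set.mem_iInter.1 hz k
    rw [Set.mem_ofPred_eq, sub_self, norm_zero] at h
    norm_num at h
  obtain ⟨x, c, hc⟩ := hq.exists_path_avoiding hinj hdisc hg hv hvv hfix hK hKne
  have hqc : Continuous fun t => q (c t) := hq.continuous.comp c.continuous
  have h01 : q (c 1) = q (c 0) := by
    rw [c.source, c.target]
    exact ((hq.eq_iff _ _).2 ⟨g, rfl⟩).symm
  have hdist : ∀ k k' : Fin b, k' ≠ k → (1 : ℝ) ≤ ‖(((k.1 : ℕ) : ℂ) - ((k'.1 : ℕ) : ℂ))‖ := by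
    intro k k' hkk
    have h1 : (k.1 : ℤ) - (k'.1 : ℤ) ≠ 0 := sub_ne_zero.2 fun h =>
      hkk (Fin.ext (Int.ofNat_inj.1 h)).symm
    have h2 : ((1 : ℤ) : ℝ) ≤ ((|(k.1 : ℤ) - (k'.1 : ℤ)| : ℤ) : ℝ) :=
      Int.cast_le.2 (Int.one_le_abs h1)
    rw [Int.cast_one, Int.cast_abs, ← Complex.norm_intCast, Int.cast_sub, Int.cast_natCast,
      Int.cast_natCast] at h2
    exact h2
  have hnear : ∀ k : Fin b, (∃ t, ‖q (c t) - ((k.1 : ℕ) : ℂ)‖ < 1 / 3) →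
      ∀ t, ‖q (c t) - ((k.1 : ℕ) : ℂ)‖ < 1 / 3 := by
    rintro k ⟨t₀, ht₀⟩
    have hcont : Continuous fun t => ‖q (c t) - ((k.1 : ℕ) : ℂ)‖ :=
      (hqc.sub continuous_const).norm
    have hsub := (isPreconnected_univ (α := unitInterval)).subset_left_of_subset_union
      (u := {t | ‖q (c t) - ((k.1 : ℕ) : ℂ)‖ < 1 / 3})
      (v := {t | 1 / 3 < ‖q (c t) - ((k.1 : ℕ) : ℂ)‖})
      (isOpen_lt hcont continuous_const) (isOpen_lt continuous_const hcont)
      (Set.disjoint_left.2 fun t h1 h2 => by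
        rw [Set.mem_ofPred_eq] at h1 h2
        exact lt_asymm h1 h2)
      (fun t _ => by
        by_contra hcon
        simp only [Set.mem_union, Set.mem_ofPred_eq, not_or, not_lt] at hcon
        have heq := le_antisymm hcon.2 hcon.1
        refine hc t ⟨?_, Set.mem_iInter.2 fun k' => ?_⟩
        · rw [mem_closedBall_zero_iff]
          have h1 : ‖((k.1 : ℕ) : ℂ)‖ = k.1 := by simp
          have h2 : (k.1 : ℝ) + 1 ≤ b := by exact_mod_cast k.2
          have h3 := norm_add_le (q (c t) - ((k.1 : ℕ) : ℂ)) ((k.1 : ℕ) : ℂ)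
          rw [sub_add_cancel] at h3
          linarith
        · rw [Set.mem_ofPred_eq]
          by_cases hkk : k' = k
          · rw [hkk, heq]
          · have h3 := norm_sub_le (q (c t) - ((k'.1 : ℕ) : ℂ)) (q (c t) - ((k.1 : ℕ) : ℂ))
            rw [sub_sub_sub_cancel_left] at h3
            have := hdist k k' hkk
            linarith)
      ⟨t₀, Set.mem_univ _, ht₀⟩
    exact fun t => hsub (Set.mem_univ t)
  by_cases hex : ∃ k : Fin b, ∃ t, ‖q (c t) - ((k.1 : ℕ) : ℂ)‖ < 1 / 3
  · obtain ⟨k, hk⟩ := hex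
    refine Or.inl ⟨k, fun k' hkk => ?_⟩
    have hk := hnear k hk
    have hd := hdist k k' hkk
    have hne : ((k.1 : ℕ) : ℂ) - ((k'.1 : ℕ) : ℂ) ≠ 0 := norm_pos_iff.1 (by linarith)
    -- Near `k`, the function `z - k'` is a constant times a function with values near one.
    have hslit : ∀ t, (q (c t) - (k'.1 : ℕ)) / (((k.1 : ℕ) : ℂ) - ((k'.1 : ℕ) : ℂ)) ∈
        Complex.slitPlane := by
      intro t
      have h1 : (q (c t) - (k'.1 : ℕ)) / (((k.1 : ℕ) : ℂ) - ((k'.1 : ℕ) : ℂ))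
          = 1 + (q (c t) - ((k.1 : ℕ) : ℂ)) / (((k.1 : ℕ) : ℂ) - ((k'.1 : ℕ) : ℂ)) := by
        field_simp
        ring
      rw [h1]
      apply Complex.mem_slitPlane_of_norm_lt_one
      rw [norm_div, div_lt_one (by linarith)]
      linarith [hk t]
    rw [(hw k').eq_of_path c (l := fun t => Complex.log ((q (c t) - (k'.1 : ℕ)) /
        (((k.1 : ℕ) : ℂ) - ((k'.1 : ℕ) : ℂ))) +
        Complex.log (((k.1 : ℕ) : ℂ) - ((k'.1 : ℕ) : ℂ)))
      ((Continuous.clog ((hqc.sub continuous_const).div_const _) hslit).add continuous_const)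
      (fun t => by
        rw [Complex.exp_add, Complex.exp_log (Complex.slitPlane_ne_zero (hslit t)),
          Complex.exp_log hne, div_mul_cancel₀ _ hne])]
    rw [h01, sub_self]
  · push Not at hex
    refine Or.inr fun k k' => ?_
    have hfar : ∀ t, (b : ℝ) < ‖q (c t)‖ := fun t => by
      by_contra! h
      exact hc t ⟨mem_closedBall_zero_iff.2 h, Set.mem_iInter.2 fun k => hex k t⟩
    have hq0 : ∀ t, q (c t) ≠ 0 := fun t =>
      norm_pos_iff.1 ((Nat.cast_nonneg b).trans_lt (hfar t))
    -- Near `∞`, the function `z - k` is `z` times a function with values near one.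
    have hslit : ∀ (k : Fin b) t, (q (c t) - (k.1 : ℕ)) / q (c t) ∈ Complex.slitPlane := by
      intro k t
      have h1 : (q (c t) - (k.1 : ℕ)) / q (c t) = 1 + -((k.1 : ℕ) : ℂ) / q (c t) := by
        have := hq0 t
        field_simp
        ring
      rw [h1]
      apply Complex.mem_slitPlane_of_norm_lt_one
      rw [norm_div, div_lt_one (norm_pos_iff.2 (hq0 t)), norm_neg, Complex.norm_natCast]
      have h2 : (k.1 : ℝ) < b := Nat.cast_lt.2 k.2
      exact h2.trans (hfar t)
    obtain ⟨l, hl, hexp, hlw⟩ := (hw k').exists_log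
    have hlog : ∀ k : Fin b, Continuous fun t => Complex.log ((q (c t) - (k.1 : ℕ)) / q (c t)) :=
      fun k => Continuous.clog ((hqc.sub continuous_const).div hqc hq0) (hslit k)
    rw [(hw k).eq_of_path c (l := fun t => l (c t) +
        Complex.log ((q (c t) - (k.1 : ℕ)) / q (c t)) -
        Complex.log ((q (c t) - (k'.1 : ℕ)) / q (c t)))
      (((hl.comp c.continuous).add (hlog k)).sub (hlog k')) (fun t => by
        have h1 := sub_ne_zero.2 (hq.ne_puncture (c t) k')
        have h2 := hq0 t
        rw [Complex.exp_sub, Complex.exp_add, hexp,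
          Complex.exp_log (Complex.slitPlane_ne_zero (hslit k t)),
          Complex.exp_log (Complex.slitPlane_ne_zero (hslit k' t))]
        field_simp)]
    rw [h01, c.source, c.target, hlw]
    ring

/-- The dividing curves are hyperbolic: they separate two punctures `0`, `1` from the puncture
`b - 1` and `∞`, which their winding numbers would not allow if they were parabolic. -/
theorem isHyperbolic_divd {b : ℕ} {ρ : FreeGroup (Fin b) →* SO21} (hρ : IsFuchsianHolonomy b ρ)
    (j : Fin (b - 2)) : IsHyperbolic (ρ (divd b j)) := by
  obtain ⟨q, x₀, hq⟩ := hρ.exists_uniformization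
  choose w hw using hq.exists_winding
  have hj := j.2
  have hwj : ∀ k, w k (divd b j) = if k.1 < j.1 + 2 then -(2 * Real.pi * Complex.I) else 0 := by
    intro k
    rw [divd, (hw k).map_inv x₀, (hw k).initialProd hq (by omega)]
    split_ifs <;> simp
  have hpi : -(2 * Real.pi * Complex.I) ≠ 0 := neg_ne_zero.2 Complex.two_pi_I_ne_zero
  -- `b ≥ 3` holds, as there is a `j : Fin (b - 2)`.
  let k₀ : Fin b := ⟨0, by omega⟩
  let k₁ : Fin b := ⟨1, by omega⟩
  let k₂ : Fin b := ⟨b - 1, by omega⟩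
  have h0 : w k₀ (divd b j) ≠ 0 := by rw [hwj, if_pos (by simp [k₀])]; exact hpi
  have h1 : w k₁ (divd b j) ≠ 0 := by rw [hwj, if_pos (by simp [k₁])]; exact hpi
  have h2 : w k₂ (divd b j) = 0 := by rw [hwj, if_neg (by simp only [k₂]; omega)]
  have hne : divd b j ≠ 1 := fun h => h0 (by rw [h, (hw k₀).map_one x₀])
  have hne' : ρ (divd b j) ≠ 1 := fun h => hne ((map_eq_one_iff ρ hρ.faithful).1 h)
  obtain ⟨v, hv, hfix⟩ := exists_fixed_vector (ρ (divd b j))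
  rcases lt_trichotomy (lorentz v v) 0 with hvv | hvv | hvv
  · exfalso
    have key : ∀ v, IsFutureTimelike v → act (ρ (divd b j)) v = v → False := fun v hv hfix => by
      refine hne' (eq_one_of_fixed hρ.discrete (range_torsionFree hρ.faithful) ⟨_, rfl⟩
        (Hyp.normalize v hv).2 ?_)
      change act _ (_ • v) = _ • v
      rw [act_smul, hfix]
    rcases isFutureTimelike_or_neg hvv with h | h
    · exact key v h hfix
    · exact key (-v) h (by rw [act_neg, hfix])
  · exfalso
    rcases hq.winding_of_parabolic hρ.faithful hρ.discrete hne hv hvv hfix hw with ⟨k, hk⟩ | h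
    · by_cases hk0 : k₀ = k
      · exact h1 (hk k₁ (by rw [← hk0]; simp [k₀, k₁]))
      · exact h0 (hk k₀ hk0)
    · exact h0 ((h k₀ k₂).trans h2)
  · obtain ⟨f, hf⟩ := exists_frame_of_spacelike hne' hvv hfix
    exact hf.isHyperbolic

variable {b : ℕ} {ρ : FreeGroup (Fin b) →* SO21}

/-! ### Commutation in the free group -/

/-- Mapping `g₁` and `gₙ₊₁` to noncommuting transpositions and the other generators to one shows
that `g₁ ⋯ gₙ` does not commute with `gₙ₊₁`. -/
lemma initialProd_not_commute {n : ℕ} (hn : 1 ≤ n) (hnb : n < b) :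
    initialProd b n * FreeGroup.of ⟨n, hnb⟩ ≠ FreeGroup.of ⟨n, hnb⟩ * initialProd b n := by
  intro h
  let φ : FreeGroup (Fin b) →* Equiv.Perm (Fin 3) := FreeGroup.lift fun i =>
    if i.1 = 0 then Equiv.swap 0 1 else if i.1 = n then Equiv.swap 1 2 else 1
  have hP : ∀ m, 1 ≤ m → m ≤ n → φ (initialProd b m) = Equiv.swap 0 1 := by
    intro m hm
    induction m, hm using Nat.le_induction with
    | base =>
      intro _
      rw [initialProd_succ (by omega), initialProd_zero, one_mul]
      simp [φ]
    | succ m hm ih =>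
      intro hmn
      rw [initialProd_succ (by omega), map_mul, ih (by omega)]
      have h1 : φ (FreeGroup.of ⟨m, by omega⟩) = 1 := by
        simp only [φ, FreeGroup.lift_apply_of]
        rw [if_neg (by omega), if_neg (by omega)]
      rw [h1, mul_one]
  have h2 := congrArg φ h
  have h3 : φ (FreeGroup.of ⟨n, hnb⟩) = Equiv.swap 1 2 := by
    simp only [φ, FreeGroup.lift_apply_of]
    rw [if_neg (by omega), if_pos trivial]
  rw [map_mul, map_mul, hP n hn le_rfl, h3] at h2
  revert h2
  decide

lemma commute_of_plus_orthogonal (hρ : IsFuchsianHolonomy b ρ) {g h : FreeGroup (Fin b)}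
    (hg : IsHyperbolic (ρ g)) (hh : IsHyperbolic (ρ h))
    (horth : lorentz (Xplus (ρ g)) (X0 (ρ h)) = 0) : g * h = h * g := by
  have h1 := commute_of_orthogonal hρ.discrete ⟨g, rfl⟩ ⟨h, rfl⟩ hg.isFrame hh.isFrame horth
  rw [← map_mul, ← map_mul] at h1
  exact hρ.faithful h1

lemma eq_zero_of_fixed_of_fixed (hρ : IsFuchsianHolonomy b ρ) {g h : FreeGroup (Fin b)}
    (hg : IsHyperbolic (ρ g)) (hh : IsHyperbolic (ρ h)) (hgh : g * h ≠ h * g) {v : R21}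
    (hgv : act (ρ g) v = v) (hhv : act (ρ h) v = v) : v = 0 := by
  obtain ⟨c, hc⟩ := hg.isFrame.fixed_eq hgv
  obtain ⟨d, hd⟩ := hh.isFrame.fixed_eq hhv
  by_contra hv
  refine hgh (commute_of_plus_orthogonal hρ hg hh ?_)
  have hd0 : d ≠ 0 := by
    rintro rfl
    exact hv (by rw [hd, zero_smul])
  have h1 : lorentz (frame (ρ g)).plus v = 0 := by
    rw [hc, lorentz_smul_right, hg.isFrame.orth_plus, mul_zero]
  rw [hd, lorentz_smul_right] at h1
  exact (mul_eq_zero.1 h1).resolve_left hd0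

lemma bdry_of_lt {i : Fin (b + 1)} (h : i.1 < b) : bdry b i = FreeGroup.of ⟨i.1, h⟩ := by
  rw [bdry, dif_pos h]

lemma bdry_castSucc (i : Fin b) : bdry b i.castSucc = FreeGroup.of i := bdry_of_lt i.2

lemma bdry_last (b : ℕ) : bdry b (Fin.last b) = (initialProd b b)⁻¹ := by
  rw [bdry, dif_neg (by simp)]

lemma isHyperbolic_of (hρ : IsFuchsianHolonomy b ρ) (i : Fin b) :
    IsHyperbolic (ρ (FreeGroup.of i)) := by
  rw [← bdry_castSucc]
  exact hρ.peripheral _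

/-- The elements `(g₁ ⋯ gₙ)⁻¹` are among the boundary and dividing elements. -/
lemma inv_initialProd_eq {n : ℕ} (hn : 2 ≤ n) (hnb : n ≤ b) :
    (∃ i, (initialProd b n)⁻¹ = bdry b i) ∨ ∃ j, (initialProd b n)⁻¹ = divd b j := by
  rcases hnb.eq_or_lt with rfl | h
  · exact Or.inl ⟨_, (bdry_last n).symm⟩
  · refine Or.inr ⟨⟨n - 2, by omega⟩, ?_⟩
    rw [divd]
    congr 2
    simp only
    omega

lemma isHyperbolic_inv_initialProd (hρ : IsFuchsianHolonomy b ρ) {n : ℕ} (hn : 2 ≤ n)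
    (hnb : n ≤ b) : IsHyperbolic (ρ (initialProd b n)⁻¹) := by
  rcases inv_initialProd_eq hn hnb with ⟨i, hi⟩ | ⟨j, hj⟩
  · rw [hi]; exact hρ.peripheral i
  · rw [hj]; exact isHyperbolic_divd hρ j

/-- The coefficient of `c_{n+1}` in the Margulis invariant of `(g₁ ⋯ gₙ₊₁)⁻¹` does not vanish. -/
lemma plus_pairing_ne_zero (hρ : IsFuchsianHolonomy b ρ) {n : ℕ} (hn : 1 ≤ n) (hnb : n < b) :
    lorentz (Xplus (ρ (FreeGroup.of ⟨n, hnb⟩))) (X0 (ρ (initialProd b (n + 1))⁻¹)) ≠ 0 := by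
  intro h
  have h1 : Commute (FreeGroup.of ⟨n, hnb⟩) (initialProd b (n + 1))⁻¹ :=
    commute_of_plus_orthogonal hρ (isHyperbolic_of hρ _)
    (isHyperbolic_inv_initialProd hρ (by omega) (by omega)) h
  rw [Commute.inv_right_iff, initialProd_succ hnb] at h1
  apply initialProd_not_commute hn hnb
  have h2 := h1.eq
  rw [← mul_assoc] at h2
  exact (mul_right_cancel h2).symm

/-! ### Cocycles -/

namespace Z1

lemma map_mul (u : Z1 ρ) (g h : FreeGroup (Fin b)) :
    u.1 (g * h) = act (ρ g) (u.1 h) + u.1 g :=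
  (groupCohomology.mem_cocycles₁_iff (A := coeff ρ) u.1).1 u.2 g h

lemma map_one (u : Z1 ρ) : u.1 1 = 0 := by
  have h := map_mul u 1 1
  rw [mul_one, _root_.map_one, act_one] at h
  simpa using h

lemma map_inv (u : Z1 ρ) (g : FreeGroup (Fin b)) : u.1 g⁻¹ = -act (ρ g)⁻¹ (u.1 g) := by
  have h := map_mul u g⁻¹ g
  rw [inv_mul_cancel, map_one, _root_.map_inv] at h
  rw [eq_neg_iff_add_eq_zero, add_comm, ← h]

lemma eq_on_closure {u u' : Z1 ρ} {s : Set (FreeGroup (Fin b))} (h : ∀ g ∈ s, u.1 g = u'.1 g)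
    {g : FreeGroup (Fin b)} (hg : g ∈ Subgroup.closure s) : u.1 g = u'.1 g := by
  induction hg using Subgroup.closure_induction with
  | mem g hg => exact h g hg
  | one => rw [map_one, map_one]
  | mul g k _ _ hg hk => rw [map_mul, map_mul, hg, hk]
  | inv g _ hg => rw [map_inv, map_inv, hg]

lemma ext_of {u u' : Z1 ρ} (h : ∀ i, u.1 (FreeGroup.of i) = u'.1 (FreeGroup.of i)) : u = u' := by
  refine Subtype.ext (funext fun g => eq_on_closure (s := Set.range FreeGroup.of) ?_ ?_)
  · rintro _ ⟨i, rfl⟩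
    exact h i
  · rw [FreeGroup.closure_range_of]
    exact Subgroup.mem_top g

end Z1

/-- The affine isometry `x ↦ A x + v`. -/
def affinePerm (A : SO21) (v : R21) : Equiv.Perm R21 where
  toFun x := act A x + v
  invFun x := act A⁻¹ (x - v)
  left_inv x := by simp
  right_inv x := by simp

/-- The affine deformation of `ρ` whose translational parts at the generators are given. -/
def affineHom (ρ : FreeGroup (Fin b) →* SO21) (x : Fin b → R21) :
    FreeGroup (Fin b) →* Equiv.Perm R21 :=
  FreeGroup.lift fun i => affinePerm (ρ (FreeGroup.of i)) (x i)

lemma affineHom_apply (x : Fin b → R21) (g : FreeGroup (Fin b)) (y : R21) :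
    affineHom ρ x g y = act (ρ g) y + affineHom ρ x g 0 := by
  induction g using FreeGroup.induction_on generalizing y with
  | C1 => simp
  | of i => simp [affineHom, affinePerm]
  | inv_of i _ =>
    simp only [affineHom, _root_.map_inv, FreeGroup.lift_apply_of]
    change act _ (y - x i) = _ + act _ (0 - x i)
    simp [sub_eq_add_neg]
  | mul g h hg hh =>
    rw [_root_.map_mul, _root_.map_mul, Equiv.Perm.mul_apply, Equiv.Perm.mul_apply, hh, hg,
      hg (affineHom ρ x h 0), act_add, act_mul, add_assoc]

/-- The cocycle on the free group with given values at the generators. -/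
def cocycleOf (ρ : FreeGroup (Fin b) →* SO21) (x : Fin b → R21) : Z1 ρ :=
  ⟨fun g => affineHom ρ x g 0, (groupCohomology.mem_cocycles₁_iff _).2 fun g h => by
    rw [_root_.map_mul, Equiv.Perm.mul_apply, affineHom_apply]
    rfl⟩

lemma cocycleOf_of (x : Fin b → R21) (i : Fin b) :
    (cocycleOf ρ x).1 (FreeGroup.of i) = x i := by
  simp [cocycleOf, affineHom, affinePerm]

/-- The cocycles on the free group correspond to their values at the generators. -/
def cocycleEquiv (ρ : FreeGroup (Fin b) →* SO21) : (Fin b → R21) ≃ₗ[ℝ] Z1 ρ :=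
  LinearEquiv.symm
  { toFun := fun u i => u.1 (FreeGroup.of i)
    map_add' := fun _ _ => rfl
    map_smul' := fun _ _ => rfl
    invFun := cocycleOf ρ
    left_inv := fun _ => Z1.ext_of fun i => cocycleOf_of _ i
    right_inv := fun _ => funext fun i => cocycleOf_of _ i }

lemma cocycleEquiv_of (x : Fin b → R21) (i : Fin b) :
    (cocycleEquiv ρ x).1 (FreeGroup.of i) = x i := cocycleOf_of x i

/-- The coboundary map `v ↦ δ_v`. -/
def coboundary (ρ : FreeGroup (Fin b) →* SO21) : R21 →ₗ[ℝ] Z1 ρ where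
  toFun v := ⟨cobdry ρ v, (groupCohomology.mem_cocycles₁_iff _).2 fun g h => by
    change _ = act (ρ g) _ + _
    simp only [cobdry, act_sub, _root_.map_mul, act_mul]
    abel⟩
  map_add' v w := Subtype.ext (funext fun g => by
    change cobdry ρ _ g = cobdry ρ _ g + cobdry ρ _ g
    simp only [cobdry, act_add]
    abel)
  map_smul' c v := Subtype.ext (funext fun g => by
    change cobdry ρ _ g = c • cobdry ρ _ g
    simp only [cobdry, act_smul, smul_sub])

lemma coboundary_apply (v : R21) (g : FreeGroup (Fin b)) :
    (coboundary ρ v).1 g = v - act (ρ g) v := rfl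

lemma cls_eq_zero_iff (u : Z1 ρ) : cls ρ u = 0 ↔ ∃ v, u = coboundary ρ v := by
  refine (groupCohomology.H1π_eq_zero_iff (A := coeff ρ) u).trans ⟨?_, ?_⟩
  · rintro ⟨v, hv⟩
    refine ⟨-v, Subtype.ext (funext fun g => ?_)⟩
    rw [coboundary_apply, act_neg, neg_sub_neg]
    exact (congrFun hv g).symm
  · rintro ⟨v, rfl⟩
    refine ⟨-v, funext fun g => ?_⟩
    change act (ρ g) (-v) - -v = v - act (ρ g) v
    rw [act_neg]
    abel

lemma cls_surjective (ρ : FreeGroup (Fin b) →* SO21) : Function.Surjective (cls ρ) := fun x =>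
  groupCohomology.H1_induction_on x fun u => ⟨u, rfl⟩

/-! ### Margulis invariants -/

/-- The Margulis invariants of the boundary and dividing elements. -/
def margulisMap (ρ : FreeGroup (Fin b) →* SO21) :
    Z1 ρ →ₗ[ℝ] (Fin (b + 1) → ℝ) × (Fin (b - 2) → ℝ) where
  toFun u := (fun i => margulis ρ u (bdry b i), fun j => margulis ρ u (divd b j))
  map_add' u v := Prod.ext (funext fun _ => lorentz_add_left (u.1 _) (v.1 _) _)
    (funext fun _ => lorentz_add_left (u.1 _) (v.1 _) _)
  map_smul' c u := Prod.ext (funext fun _ => lorentz_smul_left c (u.1 _) _)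
    (funext fun _ => lorentz_smul_left c (u.1 _) _)

lemma margulisMap_eq_iff {u : Z1 ρ} {α : Fin (b + 1) → ℝ} {β : Fin (b - 2) → ℝ} :
    margulisMap ρ u = (α, β) ↔
      (∀ i, margulis ρ u (bdry b i) = α i) ∧ ∀ j, margulis ρ u (divd b j) = β j := by
  rw [Prod.ext_iff, funext_iff, funext_iff]
  rfl

lemma margulis_of_eq_cobdry {u : FreeGroup (Fin b) → R21} {g : FreeGroup (Fin b)} {v : R21}
    (hg : IsHyperbolic (ρ g)) (h : u g = cobdry ρ v g) : margulis ρ u g = 0 := by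
  have h1 : lorentz (act (ρ g) v) (X0 (ρ g)) = lorentz v (X0 (ρ g)) := by
    have h2 : act (ρ g) (X0 (ρ g)) = X0 (ρ g) := hg.isFrame.act_zero
    conv_lhs => rw [← h2]
    rw [lorentz_act]
  rw [margulis, h, cobdry, lorentz_sub_left, h1, sub_self]

lemma margulisMap_coboundary (hρ : IsFuchsianHolonomy b ρ) (v : R21) :
    margulisMap ρ (coboundary ρ v) = 0 :=
  margulisMap_eq_iff.2 ⟨fun i => margulis_of_eq_cobdry (hρ.peripheral i) rfl,
    fun j => margulis_of_eq_cobdry (isHyperbolic_divd hρ j) rfl⟩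

/-! ### The cocycles `u₀` with prescribed Margulis invariants -/

/-- The values `a₁ X₁⁰` and `aᵢ Xᵢ⁰ + cᵢ Xᵢ⁺` at the generators that have the shape required of
`u₀`, as a function of the parameters `a` and `c`. -/
def baseValues (ρ : FreeGroup (Fin b) →* SO21) :
    (Fin b → ℝ) × (Fin (b - 1) → ℝ) →ₗ[ℝ] (Fin b → R21) where
  toFun p i := p.1 i • X0 (ρ (FreeGroup.of i)) +
    if h : 0 < i.1 then p.2 ⟨i.1 - 1, by have := i.2; omega⟩ • Xplus (ρ (FreeGroup.of i)) else 0
  map_add' p r := funext fun i => by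
    simp only [Prod.fst_add, Prod.snd_add, Pi.add_apply]
    split_ifs <;> module
  map_smul' c p := funext fun i => by
    simp only [Prod.smul_fst, Prod.smul_snd, Pi.smul_apply, RingHom.id_apply, smul_eq_mul]
    split_ifs <;> module

lemma baseValues_apply_pos (p : (Fin b → ℝ) × (Fin (b - 1) → ℝ)) {i : Fin b} (h : 0 < i.1) :
    baseValues ρ p i = p.1 i • X0 (ρ (FreeGroup.of i)) +
      p.2 ⟨i.1 - 1, by have := i.2; omega⟩ • Xplus (ρ (FreeGroup.of i)) := by
  simp [baseValues, h]

lemma baseValues_apply_zero (p : (Fin b → ℝ) × (Fin (b - 1) → ℝ)) {i : Fin b} (h : i.1 = 0) :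
    baseValues ρ p i = p.1 i • X0 (ρ (FreeGroup.of i)) := by
  simp [baseValues, h]

lemma margulis_baseValues (hρ : IsFuchsianHolonomy b ρ) (p : (Fin b → ℝ) × (Fin (b - 1) → ℝ))
    (i : Fin b) : margulis ρ (cocycleEquiv ρ (baseValues ρ p)) (FreeGroup.of i) = p.1 i := by
  have hf := (isHyperbolic_of hρ i).isFrame
  have h0 : lorentz (X0 (ρ (FreeGroup.of i))) (X0 (ρ (FreeGroup.of i))) = 1 := hf.unit_zero
  have hp : lorentz (Xplus (ρ (FreeGroup.of i))) (X0 (ρ (FreeGroup.of i))) = 0 := hf.orth_plus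
  change lorentz ((cocycleEquiv ρ (baseValues ρ p)).1 (FreeGroup.of i)) _ = _
  rw [cocycleEquiv_of]
  rcases Nat.eq_zero_or_pos i.1 with h | h
  · rw [baseValues_apply_zero p h, lorentz_smul_left, h0, mul_one]
  · rw [baseValues_apply_pos p h, lorentz_add_left, lorentz_smul_left, lorentz_smul_left, h0, hp,
      mul_one, mul_zero, add_zero]

/-- The Margulis invariants determine the parameters: those of the `gᵢ` give the `aᵢ`, and those of
`(g₁ ⋯ gₙ)⁻¹` form a triangular system for the `cₙ`. -/
lemma margulisMap_baseValues_injective (hρ : IsFuchsianHolonomy b ρ) :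
    Function.Injective (margulisMap ρ ∘ₗ (cocycleEquiv ρ).toLinearMap ∘ₗ baseValues ρ) := by
  rw [← LinearMap.ker_eq_bot, LinearMap.ker_eq_bot']
  rintro ⟨a, c⟩ hp
  set u := cocycleEquiv ρ (baseValues ρ (a, c)) with hu
  obtain ⟨hb, hd⟩ := margulisMap_eq_iff.1 (show margulisMap ρ u = (0, 0) from hp)
  have ha : ∀ i, a i = 0 := fun i => by
    have h1 := margulis_baseValues hρ (a, c) i
    rw [← bdry_castSucc, hb] at h1
    exact h1.symm
  have huz : ∀ i : Fin b, i.1 = 0 → u.1 (FreeGroup.of i) = 0 := fun i h => by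
    rw [hu, cocycleEquiv_of, baseValues_apply_zero _ h]
    simp [ha]
  have hup : ∀ i : Fin b, (h : 0 < i.1) → u.1 (FreeGroup.of i) =
      c ⟨i.1 - 1, by have := i.2; omega⟩ • Xplus (ρ (FreeGroup.of i)) := fun i h => by
    rw [hu, cocycleEquiv_of, baseValues_apply_pos _ h]
    simp [ha]
  have key : ∀ n (hn : n ≤ b), u.1 (initialProd b n)⁻¹ = 0 ∧
      ∀ i : Fin (b - 1), i.1 + 1 < n → c i = 0 := by
    intro n
    induction n with
    | zero => exact fun _ => ⟨by rw [initialProd_zero, inv_one, Z1.map_one], by simp⟩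
    | succ n ih =>
      intro hn
      obtain ⟨ih1, ih2⟩ := ih (by omega)
      have h1 : u.1 (initialProd b (n + 1))⁻¹ =
          -act (ρ (FreeGroup.of ⟨n, hn⟩))⁻¹ (u.1 (FreeGroup.of ⟨n, hn⟩)) := by
        rw [initialProd_succ hn, _root_.mul_inv_rev, Z1.map_mul, ih1, act_zero, zero_add, Z1.map_inv]
      rcases Nat.eq_zero_or_pos n with rfl | hn0
      · refine ⟨?_, fun i hi => by omega⟩
        rw [h1, huz _ rfl, act_zero, neg_zero]
      · have hf := (isHyperbolic_of hρ ⟨n, hn⟩).isFrame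
        have hc : c ⟨n - 1, by omega⟩ = 0 := by
          have hm : margulis ρ u (initialProd b (n + 1))⁻¹ = 0 := by
            rcases inv_initialProd_eq (b := b) (n := n + 1) (by omega) hn with ⟨i, hi⟩ | ⟨j, hj⟩
            · rw [hi]; exact hb i
            · rw [hj]; exact hd j
          have hX : act (ρ (FreeGroup.of ⟨n, hn⟩))⁻¹ (Xplus (ρ (FreeGroup.of ⟨n, hn⟩))) =
              (frame (ρ (FreeGroup.of ⟨n, hn⟩))).lam • Xplus (ρ (FreeGroup.of ⟨n, hn⟩)) := by
            have h2 := act_inv_smul (inv_ne_zero hf.lam_pos.ne') hf.act_plus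
            rwa [inv_inv] at h2
          change lorentz (u.1 _) _ = 0 at hm
          rw [h1, hup _ hn0, act_smul, hX, lorentz_neg_left, lorentz_smul_left, lorentz_smul_left,
            neg_eq_zero] at hm
          exact (mul_eq_zero.1 hm).resolve_right
            (mul_ne_zero hf.lam_pos.ne' (plus_pairing_ne_zero hρ hn0 hn))
        refine ⟨?_, fun i hi => ?_⟩
        · rw [h1, hup _ hn0, hc, zero_smul, act_zero, neg_zero]
        · rcases Nat.lt_or_ge (i.1 + 1) n with h2 | h2
          · exact ih2 i h2
          · rw [← hc]
            congr 1
            apply Fin.ext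
            simp only
            omega
  refine Prod.ext (funext ha) (funext fun i => (key b le_rfl).2 i (by have := i.2; omega))

/-- The parameters of the cocycles `u₀` correspond to their Margulis invariants. -/
def baseEquiv (hb : 3 ≤ b) (hρ : IsFuchsianHolonomy b ρ) :
    ((Fin b → ℝ) × (Fin (b - 1) → ℝ)) ≃ₗ[ℝ] (Fin (b + 1) → ℝ) × (Fin (b - 2) → ℝ) :=
  LinearMap.linearEquivOfInjective _ (margulisMap_baseValues_injective hρ) (by
    simp only [Module.finrank_prod, Module.finrank_fin_fun]
    omega)

/-- The linear map `(α, β) ↦ u₀^{α,β}`. -/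
def baseCocycle (hb : 3 ≤ b) (hρ : IsFuchsianHolonomy b ρ) :
    (Fin (b + 1) → ℝ) × (Fin (b - 2) → ℝ) →ₗ[ℝ] Z1 ρ :=
  (cocycleEquiv ρ).toLinearMap ∘ₗ baseValues ρ ∘ₗ (baseEquiv hb hρ).symm.toLinearMap

lemma margulisMap_baseCocycle (hb : 3 ≤ b) (hρ : IsFuchsianHolonomy b ρ)
    (x : (Fin (b + 1) → ℝ) × (Fin (b - 2) → ℝ)) : margulisMap ρ (baseCocycle hb hρ x) = x :=
  (baseEquiv hb hρ).apply_symm_apply x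

lemma isBaseCocycle_iff (hb : 3 ≤ b) (hρ : IsFuchsianHolonomy b ρ) (α : Fin (b + 1) → ℝ)
    (β : Fin (b - 2) → ℝ) (u : Z1 ρ) :
    IsBaseCocycle ρ α β u ↔ u = baseCocycle hb hρ (α, β) := by
  constructor
  · intro h
    have hc : ∀ i : Fin (b - 1), ∃ c : ℝ, u.1 (FreeGroup.of ⟨i.1 + 1, by have := i.2; omega⟩) =
        α ⟨i.1 + 1, by have := i.2; omega⟩ •
          X0 (ρ (FreeGroup.of ⟨i.1 + 1, by have := i.2; omega⟩)) +
        c • Xplus (ρ (FreeGroup.of ⟨i.1 + 1, by have := i.2; omega⟩)) := fun i => by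
      have hi : i.1 + 1 < b := by have := i.2; omega
      have h1 := h.next ⟨i.1 + 1, by omega⟩ (Nat.succ_pos _) hi
      rw [bdry_of_lt (i := ⟨i.1 + 1, by omega⟩) hi] at h1
      exact h1
    choose c hc using hc
    have hu : u = cocycleEquiv ρ (baseValues ρ (fun i => α i.castSucc, c)) := by
      refine Z1.ext_of fun i => ?_
      rw [cocycleEquiv_of]
      rcases Nat.eq_zero_or_pos i.1 with hi | hi
      · rw [baseValues_apply_zero _ hi, ← bdry_castSucc]
        exact h.first i.castSucc hi
      · rw [baseValues_apply_pos _ hi]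
        have h1 := hc ⟨i.1 - 1, by have := i.2; omega⟩
        have h2 : (⟨i.1 - 1 + 1, by have := i.2; omega⟩ : Fin b) = i :=
          Fin.ext (by simp only; omega)
        have h3 : (⟨i.1 - 1 + 1, by have := i.2; omega⟩ : Fin (b + 1)) = i.castSucc :=
          Fin.ext (by simp only [Fin.val_castSucc]; omega)
        simp only [h2, h3] at h1
        exact h1
    have hm : margulisMap ρ u = (α, β) := margulisMap_eq_iff.2 ⟨h.margulis_bdry, h.margulis_divd⟩
    have hp : baseEquiv hb hρ (fun i => α i.castSucc, c) = (α, β) := by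
      rw [← hm, hu]
      rfl
    rw [baseCocycle, ← hp, LinearMap.comp_apply, LinearMap.comp_apply, LinearEquiv.coe_coe,
      LinearEquiv.coe_coe, LinearEquiv.symm_apply_apply]
    exact hu
  · rintro rfl
    obtain ⟨h1, h2⟩ := margulisMap_eq_iff.1 (margulisMap_baseCocycle hb hρ (α, β))
    set p := (baseEquiv hb hρ).symm (α, β) with hp
    have hval : ∀ i, (baseCocycle hb hρ (α, β)).1 (FreeGroup.of i) = baseValues ρ p i :=
      fun i => cocycleEquiv_of _ i
    have hpa : ∀ i, p.1 i = α i.castSucc := fun i => by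
      rw [← h1 i.castSucc, bdry_castSucc]
      exact (margulis_baseValues hρ p i).symm
    refine ⟨h1, h2, fun i hi => ?_, fun i hi hib => ?_⟩
    · have hib : i.1 < b := by omega
      rw [bdry_of_lt hib]
      have h3 := hval ⟨i.1, hib⟩
      rw [baseValues_apply_zero p hi, hpa] at h3
      exact h3
    · rw [bdry_of_lt hib]
      have h3 := hval ⟨i.1, hib⟩
      rw [baseValues_apply_pos p hi, hpa] at h3
      exact ⟨_, h3⟩

/-! ### Affine twists -/

/-- The affine twist along the `k`-th dividing curve: it is zero at the generators of the first pants
groups, up to the one bounded by the curve, and equal to the coboundary at all later ones. -/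
def affineTwist (ρ : FreeGroup (Fin b) →* SO21) (k : Fin (b - 2)) : Z1 ρ :=
  cocycleEquiv ρ fun i =>
    if i.1 ≤ k.1 + 1 then 0 else cobdry ρ (X0 (ρ (divd b k))) (FreeGroup.of i)

lemma affineTwist_of_le {k : Fin (b - 2)} {i : Fin b} (h : i.1 ≤ k.1 + 1) :
    (affineTwist ρ k).1 (FreeGroup.of i) = 0 := by
  rw [affineTwist, cocycleEquiv_of, if_pos h]

lemma affineTwist_of_gt {k : Fin (b - 2)} {i : Fin b} (h : k.1 + 1 < i.1) :
    (affineTwist ρ k).1 (FreeGroup.of i) =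
      (coboundary ρ (X0 (ρ (divd b k)))).1 (FreeGroup.of i) := by
  rw [affineTwist, cocycleEquiv_of, if_neg (not_le.2 h)]
  rfl

lemma affineTwist_initialProd_of_le {k : Fin (b - 2)} {n : ℕ} (hn : n ≤ k.1 + 2) :
    (affineTwist ρ k).1 (initialProd b n) = 0 := by
  induction n with
  | zero => rw [initialProd_zero, Z1.map_one]
  | succ n ih =>
    rw [initialProd_succ (by have := k.2; omega), Z1.map_mul, ih (by omega),
      affineTwist_of_le (by simp only; omega), act_zero, add_zero]

/-- From `h_k` on, the affine twist agrees with `δ_{Y_k}`, which is zero at `h_k`. -/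
lemma affineTwist_initialProd_of_ge (hρ : IsFuchsianHolonomy b ρ) {k : Fin (b - 2)} {n : ℕ}
    (hn : k.1 + 2 ≤ n) (hnb : n ≤ b) : (affineTwist ρ k).1 (initialProd b n) =
      (coboundary ρ (X0 (ρ (divd b k)))).1 (initialProd b n) := by
  induction n, hn using Nat.le_induction with
  | base =>
    have h1 : act (ρ (divd b k)) (X0 (ρ (divd b k))) = X0 (ρ (divd b k)) :=
      (isHyperbolic_divd hρ k).isFrame.act_zero
    have h2 : act (ρ (initialProd b (k.1 + 2))) (X0 (ρ (divd b k))) = X0 (ρ (divd b k)) := by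
      conv_lhs => rw [← h1]
      rw [← act_mul, ← map_mul, divd, mul_inv_cancel, map_one, act_one]
    rw [affineTwist_initialProd_of_le le_rfl, coboundary_apply, h2, sub_self]
  | succ n hn ih =>
    rw [initialProd_succ hnb, Z1.map_mul, Z1.map_mul, ih (by omega),
      affineTwist_of_gt (by simp only; omega)]

lemma of_succ_mem_pants (l : Fin (b - 1)) :
    FreeGroup.of ⟨l.1 + 1, by have := l.2; omega⟩ ∈ pants b l :=
  Subgroup.subset_closure (by simp)

lemma initialProd_succ_mem_pants (l : Fin (b - 1)) : initialProd b (l.1 + 1) ∈ pants b l :=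
  inv_mem_iff.1 (Subgroup.subset_closure (by simp))

lemma initialProd_add_two_mem_pants (l : Fin (b - 1)) : initialProd b (l.1 + 2) ∈ pants b l :=
  inv_mem_iff.1 (Subgroup.subset_closure (by simp))

/-- Every generator lies in one of the pants groups. -/
lemma exists_of_mem_pants (hb : 3 ≤ b) (i : Fin b) : ∃ l, FreeGroup.of i ∈ pants b l := by
  rcases Nat.eq_zero_or_pos i.1 with hi | hi
  · refine ⟨⟨0, by omega⟩, ?_⟩
    have h := initialProd_succ_mem_pants (b := b) ⟨0, by omega⟩
    rw [initialProd_succ (by simp only; omega), initialProd_zero, one_mul] at h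
    rwa [show i = ⟨0, by omega⟩ from Fin.ext hi]
  · refine ⟨⟨i.1 - 1, by have := i.2; omega⟩, ?_⟩
    have h := of_succ_mem_pants (b := b) ⟨i.1 - 1, by have := i.2; omega⟩
    have h2 : (⟨i.1 - 1 + 1, by have := i.2; omega⟩ : Fin b) = i := Fin.ext (by simp only; omega)
    simpa only [h2] using h

lemma isAffineTwist_affineTwist (hρ : IsFuchsianHolonomy b ρ) (k : Fin (b - 2)) :
    IsAffineTwist ρ k (affineTwist ρ k) := by
  constructor
  · intro l hl g hg
    refine Z1.eq_on_closure (u := affineTwist ρ k) (u' := 0) ?_ hg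
    have h0 : ∀ g, (0 : Z1 ρ).1 g = 0 := fun _ => rfl
    simp only [Set.mem_insert_iff, Set.mem_singleton_iff, h0]
    rintro g (rfl | rfl | rfl)
    · rw [Z1.map_inv, affineTwist_initialProd_of_le (by omega), act_zero, neg_zero]
    · exact affineTwist_of_le (by simp only; omega)
    · rw [Z1.map_inv, affineTwist_initialProd_of_le (by omega), act_zero, neg_zero]
  · intro m hm g hg
    have hmb := m.2
    refine Z1.eq_on_closure (u := affineTwist ρ k) (u' := coboundary ρ (X0 (ρ (divd b k)))) ?_ hg
    simp only [Set.mem_insert_iff, Set.mem_singleton_iff]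
    rintro g (rfl | rfl | rfl)
    · rw [Z1.map_inv, Z1.map_inv, affineTwist_initialProd_of_ge hρ (by omega) (by omega)]
    · exact affineTwist_of_gt (by simp only; omega)
    · rw [Z1.map_inv, Z1.map_inv, affineTwist_initialProd_of_ge hρ (by omega) (by omega)]

lemma isAffineTwist_iff (hb : 3 ≤ b) (hρ : IsFuchsianHolonomy b ρ) (k : Fin (b - 2)) (a : Z1 ρ) :
    IsAffineTwist ρ k a ↔ a = affineTwist ρ k := by
  constructor
  · intro h
    have h' := isAffineTwist_affineTwist hρ k
    refine Z1.ext_of fun i => ?_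
    obtain ⟨l, hl⟩ := exists_of_mem_pants hb i
    rcases le_or_gt l.1 k.1 with hlk | hlk
    · exact (h.before l hlk _ hl).trans (h'.before l hlk _ hl).symm
    · exact (h.after l hlk _ hl).trans (h'.after l hlk _ hl).symm
  · rintro rfl
    exact isAffineTwist_affineTwist hρ k

/-- Affine twists have zero Margulis invariants on the pants groups, as they agree with a coboundary
on each of them. -/
lemma margulis_affineTwist (hρ : IsFuchsianHolonomy b ρ) (k : Fin (b - 2)) {l : Fin (b - 1)}
    {g : FreeGroup (Fin b)} (hg : g ∈ pants b l) (hhyp : IsHyperbolic (ρ g)) :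
    margulis ρ (affineTwist ρ k) g = 0 := by
  have h := isAffineTwist_affineTwist hρ k
  rcases le_or_gt l.1 k.1 with hlk | hlk
  · refine margulis_of_eq_cobdry (v := 0) hhyp ((h.before l hlk g hg).trans ?_)
    simp [cobdry]
  · exact margulis_of_eq_cobdry hhyp (h.after l hlk g hg)

lemma margulisMap_affineTwist (hb : 3 ≤ b) (hρ : IsFuchsianHolonomy b ρ) (k : Fin (b - 2)) :
    margulisMap ρ (affineTwist ρ k) = 0 := by
  refine margulisMap_eq_iff.2 ⟨fun i => ?_, fun j => ?_⟩
  · have : ∃ l, bdry b i ∈ pants b l := by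
      rcases lt_or_ge i.1 b with hi | hi
      · rw [bdry_of_lt hi]
        exact exists_of_mem_pants hb _
      · obtain rfl : i = Fin.last b :=
          Fin.ext (by have := i.2; simp only [Fin.val_last]; omega)
        refine ⟨⟨b - 2, by omega⟩, ?_⟩
        rw [bdry_last, inv_mem_iff]
        have h := initialProd_add_two_mem_pants (b := b) ⟨b - 2, by omega⟩
        have h2 : b - 2 + 2 = b := by omega
        simpa only [h2] using h
    obtain ⟨l, hl⟩ := this
    exact margulis_affineTwist hρ k hl (hρ.peripheral i)
  · refine margulis_affineTwist hρ k (l := ⟨j.1, by have := j.2; omega⟩) ?_ (isHyperbolic_divd hρ j)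
    exact inv_mem (initialProd_add_two_mem_pants (b := b) ⟨j.1, by have := j.2; omega⟩)

/-! ### The parametrization of the cohomology -/

/-- The cocycle `u₀^{α,β} + ∑ tₖ ATₖ` of the class with parameters `(α, β, t)`. -/
def paramCocycle (hb : 3 ≤ b) (hρ : IsFuchsianHolonomy b ρ) : D b →ₗ[ℝ] Z1 ρ :=
  (baseCocycle hb hρ).coprod (Fintype.linearCombination ℝ (affineTwist ρ)) ∘ₗ
    (LinearEquiv.prodAssoc ℝ _ _ _).symm.toLinearMap

lemma paramCocycle_apply (hb : 3 ≤ b) (hρ : IsFuchsianHolonomy b ρ) (α : Fin (b + 1) → ℝ)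
    (β t : Fin (b - 2) → ℝ) : paramCocycle hb hρ (α, β, t) =
      baseCocycle hb hρ (α, β) + ∑ k, t k • affineTwist ρ k := by
  simp only [paramCocycle, LinearMap.comp_apply, LinearMap.coprod_apply,
    Fintype.linearCombination_apply]
  rfl

/-- All cocycles as sums of a cocycle `u₀^{α,β} + ∑ tₖ ATₖ` and a coboundary. -/
def totalMap (hb : 3 ≤ b) (hρ : IsFuchsianHolonomy b ρ) : D b × R21 →ₗ[ℝ] Z1 ρ :=
  (paramCocycle hb hρ).coprod (coboundary ρ)

lemma margulisMap_totalMap (hb : 3 ≤ b) (hρ : IsFuchsianHolonomy b ρ) (α : Fin (b + 1) → ℝ)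
    (β t : Fin (b - 2) → ℝ) (v : R21) : margulisMap ρ (totalMap hb hρ ((α, β, t), v)) = (α, β) := by
  rw [totalMap, LinearMap.coprod_apply, paramCocycle_apply, map_add, map_add, map_sum,
    margulisMap_baseCocycle, margulisMap_coboundary hρ]
  simp [margulisMap_affineTwist hb hρ]

/-- The Margulis invariants detect `α` and `β`. A coboundary `δ_v` that cancels affine twists
vanishes on `P₁`, so that `v = 0`. If `t_k` is the first nonzero parameter, then `Y_k` would be
fixed by `g_{k+2}`. -/
lemma totalMap_injective (hb : 3 ≤ b) (hρ : IsFuchsianHolonomy b ρ) :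
    Function.Injective (totalMap hb hρ) := by
  rw [← LinearMap.ker_eq_bot, LinearMap.ker_eq_bot']
  rintro ⟨⟨α, β, t⟩, v⟩ h0
  have hαβ : (α, β) = ((0, 0) : (Fin (b + 1) → ℝ) × (Fin (b - 2) → ℝ)) := by
    rw [← margulisMap_totalMap hb hρ α β t v, h0, map_zero]
    rfl
  rw [totalMap, LinearMap.coprod_apply, paramCocycle_apply, hαβ, Prod.mk_zero_zero, map_zero,
    zero_add] at h0
  have hval : ∀ i : Fin b, ∑ k, t k • (affineTwist ρ k).1 (FreeGroup.of i) +
      (v - act (ρ (FreeGroup.of i)) v) = 0 := fun i => by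
    have h1 := congrArg (fun u : Z1 ρ => u.1 (FreeGroup.of i)) h0
    simpa [Finset.sum_apply, coboundary_apply] using h1
  have hfix : ∀ i : Fin b, i.1 ≤ 1 → act (ρ (FreeGroup.of i)) v = v := fun i hi => by
    have h1 := hval i
    rw [Finset.sum_eq_zero fun k _ => by rw [affineTwist_of_le (by omega), smul_zero], zero_add,
      sub_eq_zero] at h1
    exact h1.symm
  have hv : v = 0 := by
    refine eq_zero_of_fixed_of_fixed hρ (isHyperbolic_of hρ ⟨0, by omega⟩)
      (isHyperbolic_of hρ ⟨1, by omega⟩) ?_ (hfix _ (by simp)) (hfix _ (by simp))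
    have h1 := initialProd_not_commute (b := b) (n := 1) le_rfl (by omega)
    rwa [initialProd_succ (by omega), initialProd_zero, one_mul] at h1
  have ht : ∀ (n : ℕ) (hn : n < b - 2), t ⟨n, hn⟩ = 0 := by
    intro n
    induction n using Nat.strong_induction_on with
    | _ n ih =>
      intro hn
      have h1 := hval ⟨n + 2, by omega⟩
      rw [Finset.sum_eq_single ⟨n, hn⟩ (fun k _ hk => ?_) (by simp), hv, act_zero, sub_zero,
        add_zero, affineTwist_of_gt (by simp only; omega), coboundary_apply] at h1
      · by_contra htn
        have h2 := (smul_eq_zero.1 h1).resolve_left htn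
        have hY := isHyperbolic_divd hρ ⟨n, hn⟩
        have h3 : X0 (ρ (divd b ⟨n, hn⟩)) = 0 := by
          refine eq_zero_of_fixed_of_fixed hρ (isHyperbolic_of hρ ⟨n + 2, by omega⟩) hY ?_
            (sub_eq_zero.1 h2).symm hY.isFrame.act_zero
          intro hcomm
          have hc : Commute (FreeGroup.of ⟨n + 2, by omega⟩) (initialProd b (n + 2))⁻¹ := hcomm
          rw [Commute.inv_right_iff] at hc
          exact initialProd_not_commute (by omega) (by omega) hc.eq.symm
        have h4 : lorentz (X0 (ρ (divd b ⟨n, hn⟩))) (X0 (ρ (divd b ⟨n, hn⟩))) = 1 :=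
          hY.isFrame.unit_zero
        rw [h3, lorentz_zero_left] at h4
        exact zero_ne_one h4
      · rcases lt_trichotomy k.1 n with h2 | h2 | h2
        · rw [ih k.1 h2 k.2, zero_smul]
        · exact absurd (Fin.ext h2) hk
        · rw [affineTwist_of_le (by simp only; omega), smul_zero]
  have ht0 : t = 0 := funext fun k => ht k.1 k.2
  obtain ⟨hα, hβ⟩ := Prod.ext_iff.1 hαβ
  simp only at hα hβ
  rw [hα, hβ, ht0, hv]
  rfl

lemma totalMap_surjective (hb : 3 ≤ b) (hρ : IsFuchsianHolonomy b ρ) :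
    Function.Surjective (totalMap hb hρ) := by
  have hfd : Module.Finite ℝ (Z1 ρ) := Module.Finite.equiv (cocycleEquiv ρ)
  refine (LinearMap.injective_iff_surjective_of_finrank_eq_finrank ?_).1
    (totalMap_injective hb hρ)
  rw [← (cocycleEquiv ρ).finrank_eq, Module.finrank_pi_fintype]
  simp only [Module.finrank_prod, Module.finrank_fin_fun, Finset.sum_const, Finset.card_univ,
    Fintype.card_fin, smul_eq_mul]
  omega

lemma cls_paramCocycle_bijective (hb : 3 ≤ b) (hρ : IsFuchsianHolonomy b ρ) :
    Function.Bijective (cls ρ ∘ₗ paramCocycle hb hρ) := by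
  constructor
  · rw [← LinearMap.ker_eq_bot, LinearMap.ker_eq_bot']
    intro d hd
    obtain ⟨v, hv⟩ := (cls_eq_zero_iff _).1 hd
    have h : totalMap hb hρ (d, -v) = totalMap hb hρ 0 := by
      rw [totalMap, LinearMap.coprod_apply, hv, map_neg, map_zero, add_neg_cancel]
    exact congrArg Prod.fst (totalMap_injective hb hρ h)
  · intro x
    obtain ⟨u, rfl⟩ := cls_surjective ρ x
    obtain ⟨⟨d, v⟩, rfl⟩ := totalMap_surjective hb hρ u
    refine ⟨d, ?_⟩
    rw [totalMap, LinearMap.coprod_apply, map_add, (cls_eq_zero_iff (coboundary ρ v)).2 ⟨v, rfl⟩,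
      add_zero, LinearMap.comp_apply]

end HoledSphere

end

open HoledSphere in
theorem theorem1 (b : ℕ) (hb : 3 ≤ b) (ρ : FreeGroup (Fin b) →* SO21)
    (hρ : IsFuchsianHolonomy b ρ) :
    (∀ j : Fin (b - 2), IsHyperbolic (ρ (divd b j))) ∧
    Module.finrank ℝ (D b) = 3 * b - 3 ∧
    ∃ (u₀ : (Fin (b + 1) → ℝ) × (Fin (b - 2) → ℝ) →ₗ[ℝ] Z1 ρ)
      (AT : Fin (b - 2) → Z1 ρ) (Φ : D b ≃ₗ[ℝ] H1 ρ),
      (∀ (α : Fin (b + 1) → ℝ) (β : Fin (b - 2) → ℝ) (u : Z1 ρ),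
        IsBaseCocycle ρ α β u ↔ u = u₀ (α, β)) ∧
      (∀ (k : Fin (b - 2)) (a : Z1 ρ), IsAffineTwist ρ k a ↔ a = AT k) ∧
      (∀ (α : Fin (b + 1) → ℝ) (β t : Fin (b - 2) → ℝ),
        Φ (α, β, t) = cls ρ (u₀ (α, β) + ∑ k, t k • AT k)) ∧
      ∀ (α : Fin (b + 1) → ℝ) (β t : Fin (b - 2) → ℝ) (u : Z1 ρ),
        cls ρ u = Φ (α, β, t) →
          (∀ i, margulis ρ u (bdry b i) = α i) ∧ ∀ j, margulis ρ u (divd b j) = β j := by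
  refine ⟨isHyperbolic_divd hρ, ?_, baseCocycle hb hρ, affineTwist ρ,
    LinearEquiv.ofBijective _ (cls_paramCocycle_bijective hb hρ), isBaseCocycle_iff hb hρ,
    isAffineTwist_iff hb hρ, fun α β t => ?_, fun α β t u hu => ?_⟩
  · simp only [Module.finrank_prod, Module.finrank_fin_fun]
    omega
  · rw [LinearEquiv.ofBijective_apply, LinearMap.comp_apply, paramCocycle_apply]
  · rw [LinearEquiv.ofBijective_apply, LinearMap.comp_apply, ← sub_eq_zero, ← map_sub,
      cls_eq_zero_iff] at hu
    obtain ⟨v, hv⟩ := hu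
    refine margulisMap_eq_iff.1 ?_
    rw [sub_eq_iff_eq_add'.1 hv]
    exact margulisMap_totalMap hb hρ α β t v
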